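/- Let $a:\mathbf R^2\to\mathbf R$ be a bounded function of class $C^2$ with $a(x)\ge 0$ for all $x\in\mathbf R^2$, and suppose there are constants $L>0$ and $\varepsilon_0>0$ such that $a(x)\ge\varepsilon_0$ for all $x\in\mathbf R^2$ with $|x|>L$. Let $u_0,u_1\in C_0^\infty(\mathbf R^2)$ be real-valued with $\operatorname{supp}u_j\subset\{x\in\mathbf R^2:|x|\le R\}$ $(j=0,1)$ for some $R>0$. Let $u\in C^2([0,\infty)\times\mathbf R^2)$ be the real-valued classical solution (that is, any $C^2$ solution) of the Cauchy problem $$u_{tt}(t,x)-\Delta u(t,x)+a(x)u_t(t,x)=0,\quad (t,x)\in(0,\infty)\times\mathbf R^2,$$ $$u(0,x)=u_0(x),\quad u_t(0,x)=u_1(x),\quad x\in\mathbf R^2,$$ and let $$E_u(t)=\frac12\int_{\mathbf R^2}\bigl(|u_t(t,x)|^2+|\nabla u(t,x)|^2\bigr)\,dx$$ be its total energy. Then $\int_{\mathbf R^2}|u(t,x)|^2\,dx$ and $E_u(t)$ are finite for every $t\ge 0$, and $$\int_{\mathbf R^2}|u(t,x)|^2\,dx=O(t^{-1}\log t),\qquad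 E_u(t)=O(t^{-2}\log t)\qquad(t\to\infty).$$ -/

import Mathlib

open Set Filter Topology MeasureTheory Asymptotics
open scoped ContDiff

noncomputable section

namespace DampedWave

/-- The Euclidean plane. -/
abbrev Plane : Type := EuclideanSpace ℝ (Fin 2)

/-- The time derivative `u_t (t, x)` of a function on `[0, ∞) × ℝ²`: the ordinary derivative in `t`
for `t > 0`, the derivative from the right at `t = 0`. -/
def timeDeriv (u : ℝ → Plane → ℝ) (t : ℝ) (x : Plane) : ℝ :=
  derivWithin (fun s => u s x) (Ici 0) t

/-- `u` is a classical solution of the Cauchy problem `u_tt - Δu + a(x) u_t = 0` in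
`(0, ∞) × ℝ²`, `u(0, ·) = u₀`, `u_t(0, ·) = u₁`: it is of class `C²` on `[0, ∞) × ℝ²` and the
equations hold pointwise. The values of `u` at negative times play no role. -/
structure IsClassicalSolution (a u₀ u₁ : Plane → ℝ) (u : ℝ → Plane → ℝ) : Prop where
  contDiffOn : ContDiffOn ℝ 2 (fun p : ℝ × Plane => u p.1 p.2) (Ici 0 ×ˢ univ)
  equation : ∀ t : ℝ, 0 < t → ∀ x : Plane,
    timeDeriv (timeDeriv u) t x - Laplacian.laplacian (u t) x + a x * timeDeriv u t x = 0
  initial_value : ∀ x : Plane, u 0 x = u₀ x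
  initial_velocity : ∀ x : Plane, timeDeriv u 0 x = u₁ x

/-- The energy density `|u_t|² + |∇u|²` at time `t`. -/
def energyDensity (u : ℝ → Plane → ℝ) (t : ℝ) (x : Plane) : ℝ :=
  |timeDeriv u t x| ^ 2 + ‖gradient (u t) x‖ ^ 2

/-- The total energy `E_u(t) = ½ ∫ (|u_t|² + |∇u|²) dx`. -/
def energy (u : ℝ → Plane → ℝ) (t : ℝ) : ℝ :=
  (1 / 2) * ∫ x : Plane, energyDensity u t x

end DampedWave

end

/-! Write E for the integral of the energy density (twice the energy), N for the integral of u², A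
for that of a u² and D for that of a u_t². The energy identity E' = -2D sees the damping only where
a is positive, and three further estimates compensate for this.

Multiplying the equation by m x·∇u + u/3, where m = (1 + |x|²/L²)^(-1/2) keeps m x bounded, gives a
functional G with G' ≤ -E/24 + C D (`hasDerivAt_morawetz`, `morawetz_integrand_le`). For large K, X
= G + K E then satisfies X' ≤ -E/24 and is comparable to E + N. The comparison rests on the Poincaré
inequality N ≤ C (E + A) (`exists_integral_sq_le`), which holds because a is bounded below far out.

To control A, integrate the equation in time: the primitive V of u solves the damped wave equation
with a time-independent, compactly supported source f. Its energy minus ∫ f V is a function B with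
B' = -A. In the plane ∫ f V is dominated by the Dirichlet energy of V only up to a logarithm of the
radius of the support (`integral_weighted_sq_le`), so B ≥ -C log t (`exists_antiderivative_energy`).
This is the sole source of the logarithm in the rates.

With c = 1/24 and suitable α, β, the functional (t + α) X + β B + (c/2) t² E is nonincreasing
(`decay_of_lyapunov`), so t X and t² E are both O(log t); these are the two rates.

All integrations by parts need compact support in x, which is finite speed of propagation
(`IsClassicalSolution.eq_zero`), proved by a weighted energy in backward light cones. Since u is
only given for t ≥ 0, it is first replaced by a C² function on all of space-time that agrees with it
from a positive time on (`extension`). -/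

noncomputable section

namespace DampedWave

/-- Space-time `ℝ × ℝ²`. -/
abbrev SpaceTime : Type := ℝ × Plane

/-- The unit vector in the time direction. -/
def timeDir : SpaceTime := (1, 0)

/-- The unit vector in the `i`-th spatial direction. -/
def spaceDir (i : Fin 2) : SpaceTime := (0, EuclideanSpace.single i 1)

/-- The derivative of `F` in the direction `v`. -/
def pd (v : SpaceTime) (F : SpaceTime → ℝ) : SpaceTime → ℝ := fun p => fderiv ℝ F p v

/-! ### Calculus of directional derivatives on space-time. -/

section DirectionalDerivative

variable {F G : SpaceTime → ℝ} {v : SpaceTime}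

theorem pd_add (hF : Differentiable ℝ F) (hG : Differentiable ℝ G) (p : SpaceTime) :
    pd v (fun q => F q + G q) p = pd v F p + pd v G p := by
  simp [pd, fderiv_fun_add (hF p) (hG p)]

theorem pd_sub (hF : Differentiable ℝ F) (hG : Differentiable ℝ G) (p : SpaceTime) :
    pd v (fun q => F q - G q) p = pd v F p - pd v G p := by
  simp [pd, fderiv_fun_sub (hF p) (hG p)]

theorem pd_mul (hF : Differentiable ℝ F) (hG : Differentiable ℝ G) (p : SpaceTime) :
    pd v (fun q => F q * G q) p = F p * pd v G p + pd v F p * G p := by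
  simp [pd, fderiv_fun_mul (hF p) (hG p), mul_comm]

theorem pd_sq (hF : Differentiable ℝ F) (p : SpaceTime) :
    pd v (fun q => F q ^ 2) p = 2 * F p * pd v F p := by
  simp [pd, fderiv_fun_pow 2 (hF p)]

theorem pd_const (c : ℝ) (p : SpaceTime) : pd v (fun _ => c) p = 0 := by
  simp [pd]

theorem contDiff_pd {n : WithTop ℕ∞} {m : WithTop ℕ∞} (hF : ContDiff ℝ n F) (h : m + 1 ≤ n) :
    ContDiff ℝ m (pd v F) :=
  (hF.fderiv_right h).clm_apply contDiff_const

theorem continuous_pd (hF : ContDiff ℝ 1 F) : Continuous (pd v F) :=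
  (contDiff_pd (m := 0) hF (by simp)).continuous

theorem contDiff_one_pd (hF : ContDiff ℝ 2 F) : ContDiff ℝ 1 (pd v F) :=
  contDiff_pd hF (by norm_num)

theorem pd_comm (hF : ContDiff ℝ 2 F) (v w : SpaceTime) (p : SpaceTime) :
    pd v (pd w F) p = pd w (pd v F) p := by
  have hd : DifferentiableAt ℝ (fderiv ℝ F) p :=
    (hF.fderiv_right (m := 1) (by norm_num)).differentiable (by norm_num) p
  have key : ∀ a b : SpaceTime, pd a (pd b F) p = fderiv ℝ (fderiv ℝ F) p a b := by
    intro a b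
    have : HasFDerivAt (pd b F) ((fderiv ℝ (fderiv ℝ F) p).flip b) p := by
      refine (hd.hasFDerivAt.clm_apply (hasFDerivAt_const b p)).congr_fderiv ?_
      simp
    change fderiv ℝ (pd b F) p a = _
    rw [this.fderiv]
    rfl
  rw [key, key]
  exact (hF.contDiffAt.isSymmSndFDerivAt (by simp)) v w

theorem hasDerivAt_time (hF : Differentiable ℝ F) (t : ℝ) (x : Plane) :
    HasDerivAt (fun s => F (s, x)) (pd timeDir F (t, x)) t := by
  have h1 : HasDerivAt (fun s : ℝ => (s, x)) timeDir t :=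
    (hasDerivAt_id t).prodMk (hasDerivAt_const t x)
  exact (hF (t, x)).hasFDerivAt.comp_hasDerivAt t h1

theorem fderiv_slice (hF : Differentiable ℝ F) (t : ℝ) (x y : Plane) :
    fderiv ℝ (fun z => F (t, z)) x y = pd (0, y) F (t, x) := by
  have h1 : HasFDerivAt (fun z : Plane => (t, z)) (ContinuousLinearMap.inr ℝ ℝ Plane) x :=
    hasFDerivAt_prodMk_right t x
  have h2 : HasFDerivAt (fun z => F (t, z))
      ((fderiv ℝ F (t, x)).comp (ContinuousLinearMap.inr ℝ ℝ Plane)) x :=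
    (hF (t, x)).hasFDerivAt.comp x h1
  rw [h2.fderiv]
  simp [pd]

theorem pd_timeDir_comp_snd {g : Plane → ℝ} (hg : Differentiable ℝ g) (p : SpaceTime) :
    pd timeDir (fun q => g q.2) p = 0 := by
  have := (hg p.2).hasFDerivAt.comp p (hasFDerivAt_snd (𝕜 := ℝ) (p := p))
  simp only [pd]
  erw [this.fderiv]
  simp [timeDir]

theorem pd_comp_snd {g : Plane → ℝ} (hg : Differentiable ℝ g) (p : SpaceTime) (y : Plane) :
    pd (0, y) (fun q => g q.2) p = fderiv ℝ g p.2 y := by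
  have := (hg p.2).hasFDerivAt.comp p (hasFDerivAt_snd (𝕜 := ℝ) (p := p))
  simp only [pd]
  erw [this.fderiv]
  simp

end DirectionalDerivative

/-! ### Functions with spatial support growing at most at unit speed. -/

section SpatialSupport

/-- The support of `F(t, ·)` is contained in a ball whose radius grows at most with unit speed. -/
def SpatiallyBounded (F : SpaceTime → ℝ) : Prop :=
  ∃ ρ : ℝ, 0 ≤ ρ ∧ ∀ p : SpaceTime, ρ + |p.1| < ‖p.2‖ → F p = 0

variable {F G : SpaceTime → ℝ}

theorem SpatiallyBounded.mul_right (hF : SpatiallyBounded F) (G : SpaceTime → ℝ) :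
    SpatiallyBounded (fun p => F p * G p) := by
  obtain ⟨ρ, h0, h⟩ := hF
  exact ⟨ρ, h0, fun p hp => by simp [h p hp]⟩

theorem SpatiallyBounded.mul_left (hF : SpatiallyBounded F) (G : SpaceTime → ℝ) :
    SpatiallyBounded (fun p => G p * F p) := by
  obtain ⟨ρ, h0, h⟩ := hF
  exact ⟨ρ, h0, fun p hp => by simp [h p hp]⟩

theorem SpatiallyBounded.sq (hF : SpatiallyBounded F) :
    SpatiallyBounded (fun p => F p ^ 2) := by
  obtain ⟨ρ, h0, h⟩ := hF
  exact ⟨ρ, h0, fun p hp => by simp [h p hp]⟩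

theorem SpatiallyBounded.add (hF : SpatiallyBounded F) (hG : SpatiallyBounded G) :
    SpatiallyBounded (fun p => F p + G p) := by
  obtain ⟨ρ, h0, h⟩ := hF
  obtain ⟨σ, h1, h'⟩ := hG
  refine ⟨max ρ σ, le_max_of_le_left h0, fun p hp => ?_⟩
  simp only [h p (by linarith [le_max_left ρ σ]), h' p (by linarith [le_max_right ρ σ]), add_zero]

theorem SpatiallyBounded.sub (hF : SpatiallyBounded F) (hG : SpatiallyBounded G) :
    SpatiallyBounded (fun p => F p - G p) := by
  obtain ⟨ρ, h0, h⟩ := hF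
  obtain ⟨σ, h1, h'⟩ := hG
  refine ⟨max ρ σ, le_max_of_le_left h0, fun p hp => ?_⟩
  simp only [h p (by linarith [le_max_left ρ σ]), h' p (by linarith [le_max_right ρ σ]), sub_zero]

/-- The exterior region is open because its defining inequality is strict, so vanishing there passes
to derivatives with the same ρ. -/
theorem SpatiallyBounded.directional (hF : SpatiallyBounded F) (v : SpaceTime) :
    SpatiallyBounded (pd v F) := by
  obtain ⟨ρ, h0, h⟩ := hF
  refine ⟨ρ, h0, fun p hp => ?_⟩
  have hopen : IsOpen {q : SpaceTime | ρ + |q.1| < ‖q.2‖} :=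
    isOpen_lt (by fun_prop) (by fun_prop)
  have : F =ᶠ[𝓝 p] fun _ => (0 : ℝ) := by
    filter_upwards [hopen.mem_nhds hp] with q hq using h q hq
  simp [pd, this.fderiv_eq]

theorem SpatiallyBounded.hasCompactSupport (hF : SpatiallyBounded F) (t : ℝ) :
    HasCompactSupport (fun x => F (t, x)) := by
  obtain ⟨ρ, h0, h⟩ := hF
  refine HasCompactSupport.intro (isCompact_closedBall (0 : Plane) (ρ + |t|)) fun x hx => ?_
  exact h _ (by simpa using hx)

theorem SpatiallyBounded.integrable (hF : SpatiallyBounded F) (hc : Continuous F) (t : ℝ) :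
    Integrable (fun x => F (t, x)) :=
  (hc.comp (by fun_prop : Continuous fun x : Plane => (t, x))).integrable_of_hasCompactSupport
    (hF.hasCompactSupport t)

end SpatialSupport

/-! ### Differentiation under the integral and vanishing of integrated divergences. -/

section Integrals

/-- Dominated differentiation: over a compact domain the continuous derivative is bounded for
parameters in a unit ball, and that constant is the majorant. It serves both for integrals over the
plane, after truncation to a ball, and for primitives in time. -/
theorem hasFDerivAt_setIntegral_of_contDiff {H Y : Type*} [NormedAddCommGroup H]
    [NormedSpace ℝ H] [FiniteDimensional ℝ H] [NormedAddCommGroup Y] [NormedSpace ℝ Y]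
    [FiniteDimensional ℝ Y] [MeasurableSpace Y] [BorelSpace Y] (μ : Measure Y)
    [IsLocallyFiniteMeasure μ] {Φ : H × Y → ℝ} (hΦ : ContDiff ℝ 1 Φ) {K : Set Y}
    (hK : IsCompact K) (p : H) :
    HasFDerivAt (fun q => ∫ y in K, Φ (q, y) ∂μ)
      (∫ y in K, (fderiv ℝ Φ (p, y)).comp (ContinuousLinearMap.inl ℝ H Y) ∂μ) p := by
  have : ProperSpace H := FiniteDimensional.proper ℝ H
  have : ProperSpace Y := FiniteDimensional.proper ℝ Y
  have hcont : Continuous fun r : H × Y =>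
      (fderiv ℝ Φ r).comp (ContinuousLinearMap.inl ℝ H Y) :=
    (hΦ.continuous_fderiv (by norm_num)).clm_comp continuous_const
  obtain ⟨M, hM⟩ := ((isCompact_closedBall p 1).prod hK).exists_bound_of_continuousOn
    hcont.continuousOn
  have hΦc := hΦ.continuous
  refine hasFDerivAt_integral_of_dominated_of_fderiv_le (bound := fun _ => M)
    (F' := fun q y => (fderiv ℝ Φ (q, y)).comp (ContinuousLinearMap.inl ℝ H Y))
    (Metric.closedBall_mem_nhds p one_pos) ?_ ?_ ?_ ?_ ?_ ?_
  · exact Eventually.of_forall fun q =>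
      (by fun_prop : Continuous fun y => Φ (q, y)).aestronglyMeasurable
  · exact (by fun_prop : Continuous fun y => Φ (p, y)).continuousOn.integrableOn_compact hK
  · exact (hcont.comp (by fun_prop : Continuous fun y : Y => (p, y))).aestronglyMeasurable
  · filter_upwards [ae_restrict_mem hK.measurableSet] with y hy q hq
    exact hM (q, y) ⟨hq, hy⟩
  · exact integrableOn_const hK.measure_ne_top
  · refine Eventually.of_forall fun y q _ => ?_
    have h1 : HasFDerivAt (fun z : H => (z, y)) (ContinuousLinearMap.inl ℝ H Y) q :=
      hasFDerivAt_prodMk_left q y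
    exact ((hΦ.differentiable (by norm_num) (q, y)).hasFDerivAt).comp q h1

theorem contDiff_setIntegral_of_contDiff {H Y : Type*} [NormedAddCommGroup H]
    [NormedSpace ℝ H] [FiniteDimensional ℝ H] [NormedAddCommGroup Y] [NormedSpace ℝ Y]
    [FiniteDimensional ℝ Y] [MeasurableSpace Y] [BorelSpace Y] (μ : Measure Y)
    [IsLocallyFiniteMeasure μ] {Φ : H × Y → ℝ} (hΦ : ContDiff ℝ 1 Φ) {K : Set Y}
    (hK : IsCompact K) :
    ContDiff ℝ 1 (fun q => ∫ y in K, Φ (q, y) ∂μ) := by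
  have : ProperSpace H := FiniteDimensional.proper ℝ H
  have : ProperSpace Y := FiniteDimensional.proper ℝ Y
  have hcont : Continuous fun r : H × Y =>
      (fderiv ℝ Φ r).comp (ContinuousLinearMap.inl ℝ H Y) :=
    (hΦ.continuous_fderiv (by norm_num)).clm_comp continuous_const
  rw [contDiff_one_iff_fderiv]
  refine ⟨fun p => (hasFDerivAt_setIntegral_of_contDiff μ hΦ hK p).differentiableAt, ?_⟩
  have : fderiv ℝ (fun q => ∫ y in K, Φ (q, y) ∂μ) = fun p =>
      ∫ y in K, (fderiv ℝ Φ (p, y)).comp (ContinuousLinearMap.inl ℝ H Y) ∂μ :=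
    funext fun p => (hasFDerivAt_setIntegral_of_contDiff μ hΦ hK p).fderiv
  rw [this]
  exact continuous_parametric_integral_of_continuous
    (f := fun p y => (fderiv ℝ Φ (p, y)).comp (ContinuousLinearMap.inl ℝ H Y))
    hcont hK

variable {F : SpaceTime → ℝ}

theorem SpatiallyBounded.setIntegral_eq (hF : SpatiallyBounded F) (T : ℝ) :
    ∃ K : Set Plane, IsCompact K ∧
      ∀ t : ℝ, |t| ≤ T → ∫ x, F (t, x) = ∫ x in K, F (t, x) := by
  obtain ⟨ρ, h0, h⟩ := hF
  refine ⟨Metric.closedBall 0 (ρ + T), isCompact_closedBall _ _, fun t ht => ?_⟩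
  refine (setIntegral_eq_integral_of_forall_compl_eq_zero fun x hx => h _ ?_).symm
  have : ρ + T < ‖x‖ := by simpa using hx
  exact lt_of_le_of_lt (by simpa using ht) this

theorem eventually_abs_le (t : ℝ) : ∀ᶠ s in 𝓝 t, |s| ≤ |t| + 1 := by
  have : ∀ᶠ s in 𝓝 t, |s| < |t| + 1 :=
    (continuous_abs.tendsto t).eventually_lt_const (by linarith)
  exact this.mono fun s hs => hs.le

theorem SpatiallyBounded.continuous_integral (hF : SpatiallyBounded F) (hc : Continuous F) :
    Continuous fun t => ∫ x, F (t, x) := by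
  rw [continuous_iff_continuousAt]
  intro t
  obtain ⟨K, hK, hKF⟩ := hF.setIntegral_eq (|t| + 1)
  have h1 : Continuous fun s => ∫ x in K, F (s, x) :=
    continuous_parametric_integral_of_continuous (f := fun s x => F (s, x)) hc hK
  refine h1.continuousAt.congr ?_
  filter_upwards [eventually_abs_le t] with s hs using (hKF s hs).symm

theorem SpatiallyBounded.hasDerivAt_integral (hF : SpatiallyBounded F) (hc : ContDiff ℝ 1 F)
    (t : ℝ) : HasDerivAt (fun s => ∫ x, F (s, x)) (∫ x, pd timeDir F (t, x)) t := by
  obtain ⟨ρ, h0, h⟩ := hF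
  have hF : SpatiallyBounded F := ⟨ρ, h0, h⟩
  have hK : IsCompact (Metric.closedBall (0 : Plane) (ρ + (|t| + 1))) := isCompact_closedBall _ _
  have hout : ∀ s : ℝ, |s| ≤ |t| + 1 → ∀ x ∉ Metric.closedBall (0 : Plane) (ρ + (|t| + 1)),
      ρ + |s| < ‖x‖ := by
    intro s hs x hx
    have : ρ + (|t| + 1) < ‖x‖ := by simpa using hx
    linarith
  have h1 := (hasFDerivAt_setIntegral_of_contDiff volume hc hK t).hasDerivAt
  have h2 : (∫ y in Metric.closedBall (0 : Plane) (ρ + (|t| + 1)),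
      (fderiv ℝ F (t, y)).comp (ContinuousLinearMap.inl ℝ ℝ Plane)) 1
      = ∫ x, pd timeDir F (t, x) := by
    rw [ContinuousLinearMap.integral_apply]
    · refine (setIntegral_eq_integral_of_forall_compl_eq_zero fun x hx => ?_).trans ?_
      · have hx' := hout t (by linarith) x hx
        have hopen : IsOpen {q : SpaceTime | ρ + |q.1| < ‖q.2‖} :=
          isOpen_lt (by fun_prop) (by fun_prop)
        have : F =ᶠ[𝓝 (t, x)] fun _ => (0 : ℝ) := by
          filter_upwards [hopen.mem_nhds hx'] with q hq using h q hq
        simp [this.fderiv_eq]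
      · simp [pd, timeDir]
    · exact (((hc.continuous_fderiv (by norm_num)).comp
        (by fun_prop : Continuous fun y : Plane => (t, y))).clm_comp
          continuous_const).continuousOn.integrableOn_compact hK
  rw [h2] at h1
  refine h1.congr_of_eventuallyEq ?_
  filter_upwards [eventually_abs_le t] with s hs
  exact (setIntegral_eq_integral_of_forall_compl_eq_zero fun x hx => h _ (hout s hs x hx)).symm

/-- Integration by parts against the constant function 1. -/
theorem integral_fderiv_eq_zero {g : Plane → ℝ} (hg : ContDiff ℝ 1 g)
    (hs : HasCompactSupport g) (y : Plane) : ∫ x, fderiv ℝ g x y = 0 := by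
  have hi : Integrable fun x => fderiv ℝ g x y := by
    refine Continuous.integrable_of_hasCompactSupport ?_ ?_
    · exact (hg.continuous_fderiv (by norm_num)).clm_apply continuous_const
    · exact hs.fderiv_apply (𝕜 := ℝ) y
  have := integral_mul_fderiv_eq_neg_fderiv_mul_of_integrable (μ := (volume : Measure Plane))
    (f := fun _ : Plane => (1 : ℝ)) (g := g) (v := y) (by simp) (by simpa using hi)
    (by simpa using hg.continuous.integrable_of_hasCompactSupport hs)
    (fun x _ => by fun_prop) (fun x _ => hg.differentiable (by norm_num) x)
  simpa using this

theorem SpatiallyBounded.integral_pd_spaceDir (hF : SpatiallyBounded F) (hc : ContDiff ℝ 1 F)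
    (t : ℝ) (i : Fin 2) : ∫ x, pd (spaceDir i) F (t, x) = 0 := by
  have := integral_fderiv_eq_zero (g := fun x => F (t, x))
    (hc.comp (by fun_prop : ContDiff ℝ 1 fun x : Plane => (t, x)))
    (hF.hasCompactSupport t) (EuclideanSpace.single i 1)
  rw [← this]
  refine integral_congr_ae (Eventually.of_forall fun x => ?_)
  exact (fderiv_slice (hc.differentiable (by norm_num)) t x _).symm

end Integrals

/-! ### Balance laws and the weighted energy identity. -/

section BalanceLaws

variable {F J₀ J₁ : SpaceTime → ℝ}

/-- The divergence form of a balance law: spatial fluxes do not contribute to the integral. -/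
theorem hasDerivAt_integral_of_flux (hF : SpatiallyBounded F) (hJ₀ : SpatiallyBounded J₀)
    (hJ₁ : SpatiallyBounded J₁) (cF : ContDiff ℝ 1 F) (cJ₀ : ContDiff ℝ 1 J₀)
    (cJ₁ : ContDiff ℝ 1 J₁) (t : ℝ) :
    HasDerivAt (fun s => ∫ x, F (s, x))
      (∫ x, (pd timeDir F (t, x) - pd (spaceDir 0) J₀ (t, x) - pd (spaceDir 1) J₁ (t, x))) t := by
  have h0 := (hF.directional timeDir).integrable (continuous_pd cF) t
  have h1 := (hJ₀.directional (spaceDir 0)).integrable (continuous_pd cJ₀) t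
  have h2 := (hJ₁.directional (spaceDir 1)).integrable (continuous_pd cJ₁) t
  have h01 := integral_sub (h0.sub h1) h2
  simp only [Pi.sub_apply] at h01
  rw [h01, integral_sub h0 h1, hJ₀.integral_pd_spaceDir cJ₀,
    hJ₁.integral_pd_spaceDir cJ₁, sub_zero, sub_zero]
  exact hF.hasDerivAt_integral cF t

/-- The wave operator `W_tt - ΔW`. -/
def dalembert (W : SpaceTime → ℝ) (p : SpaceTime) : ℝ :=
  pd timeDir (pd timeDir W) p -
    (pd (spaceDir 0) (pd (spaceDir 0) W) p + pd (spaceDir 1) (pd (spaceDir 1) W) p)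

/-- The squared length of the spatial gradient. -/
def gradSq (W : SpaceTime → ℝ) (p : SpaceTime) : ℝ :=
  pd (spaceDir 0) W p ^ 2 + pd (spaceDir 1) W p ^ 2

/-- Twice the energy density of the wave equation. -/
def density (W : SpaceTime → ℝ) (p : SpaceTime) : ℝ :=
  pd timeDir W p ^ 2 + gradSq W p

variable {W ψ : SpaceTime → ℝ}

theorem gradSq_nonneg (p : SpaceTime) : 0 ≤ gradSq W p := by
  unfold gradSq; positivity

theorem density_nonneg (p : SpaceTime) : 0 ≤ density W p :=
  add_nonneg (sq_nonneg _) (gradSq_nonneg p)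

theorem contDiff_gradSq (hW : ContDiff ℝ 2 W) : ContDiff ℝ 1 (gradSq W) :=
  ((contDiff_one_pd hW).pow 2).add ((contDiff_one_pd hW).pow 2)

theorem contDiff_density (hW : ContDiff ℝ 2 W) : ContDiff ℝ 1 (density W) :=
  ((contDiff_one_pd hW).pow 2).add (contDiff_gradSq hW)

theorem SpatiallyBounded.gradSq (hW : SpatiallyBounded W) : SpatiallyBounded (gradSq W) :=
  (hW.directional _).sq.add (hW.directional _).sq

theorem SpatiallyBounded.density (hW : SpatiallyBounded W) : SpatiallyBounded (density W) :=
  (hW.directional _).sq.add hW.gradSq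

/-- The energy identity with a weight. -/
theorem hasDerivAt_weighted_energy (hW : ContDiff ℝ 2 W) (hψ : ContDiff ℝ 1 ψ)
    (hb : ∀ v, SpatiallyBounded (fun p => pd v W p * ψ p)) (t : ℝ) :
    HasDerivAt (fun s => ∫ x, density W (s, x) * ψ (s, x))
      (∫ x, (2 * pd timeDir W (t, x) * dalembert W (t, x) * ψ (t, x)
        + density W (t, x) * pd timeDir ψ (t, x)
        - 2 * pd timeDir W (t, x) * (pd (spaceDir 0) W (t, x) * pd (spaceDir 0) ψ (t, x)
          + pd (spaceDir 1) W (t, x) * pd (spaceDir 1) ψ (t, x)))) t := by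
  have c : ∀ v, ContDiff ℝ 1 (pd v W) := fun v => contDiff_one_pd hW
  have d : ∀ v, Differentiable ℝ (pd v W) := fun v => (c v).differentiable (by norm_num)
  have dψ : Differentiable ℝ ψ := hψ.differentiable (by norm_num)
  have ct := c timeDir
  have c0 := c (spaceDir 0)
  have c1 := c (spaceDir 1)
  have dt := d timeDir
  have d0 := d (spaceDir 0)
  have d1 := d (spaceDir 1)
  -- The flux is 2 W_t ψ ∇W. Boundedness is asked only of the products ∂W ψ, so the compact support
  -- may come from W (with ψ = 1) or from ψ (a cone weight).
  have key := hasDerivAt_integral_of_flux (F := fun p => (pd timeDir W p ^ 2 +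
      (pd (spaceDir 0) W p ^ 2 + pd (spaceDir 1) W p ^ 2)) * ψ p)
    (J₀ := fun p => 2 * (pd timeDir W p * (pd (spaceDir 0) W p * ψ p)))
    (J₁ := fun p => 2 * (pd timeDir W p * (pd (spaceDir 1) W p * ψ p)))
    (by
      convert! ((hb timeDir).mul_left (pd timeDir W)).add
        (((hb (spaceDir 0)).mul_left (pd (spaceDir 0) W)).add
        ((hb (spaceDir 1)).mul_left (pd (spaceDir 1) W))) using 2
      ring)
    (((hb _).mul_left _).mul_left fun _ => 2) (((hb _).mul_left _).mul_left fun _ => 2)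
    (by fun_prop) (by fun_prop) (by fun_prop) t
  refine key.congr_deriv (integral_congr_ae (Eventually.of_forall fun x => ?_))
  simp (disch := fun_prop) only [pd_add, pd_mul, pd_sq, pd_const]
  rw [pd_comm hW timeDir (spaceDir 0), pd_comm hW timeDir (spaceDir 1)]
  simp only [density, gradSq, dalembert]
  ring

end BalanceLaws

/-! ### Radial functions and radial vector fields. -/

section Coordinates

theorem pd_coord_timeDir (i : Fin 2) (p : SpaceTime) : pd timeDir (fun q => q.2 i) p = 0 :=
  pd_timeDir_comp_snd (g := fun x => x i) (by fun_prop) p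

theorem pd_coord_spaceDir (i j : Fin 2) (p : SpaceTime) :
    pd (spaceDir j) (fun q => q.2 i) p = if i = j then 1 else 0 := by
  rw [spaceDir, pd_comp_snd (g := fun x => x i) (by fun_prop)]
  have : HasFDerivAt (fun x : Plane => x i) (EuclideanSpace.proj (𝕜 := ℝ) i) p.2 :=
    (EuclideanSpace.proj (𝕜 := ℝ) i).hasFDerivAt
  rw [this.fderiv]
  simp

/-- The square of the distance to the spatial origin. -/
def radiusSq (p : SpaceTime) : ℝ := p.2 0 ^ 2 + p.2 1 ^ 2

theorem radiusSq_eq (p : SpaceTime) : radiusSq p = ‖p.2‖ ^ 2 := by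
  simp [radiusSq, EuclideanSpace.norm_sq_eq]

theorem radiusSq_nonneg (p : SpaceTime) : 0 ≤ radiusSq p := by
  unfold radiusSq; positivity

theorem contDiff_radiusSq {n : WithTop ℕ∞} : ContDiff ℝ n radiusSq := by
  unfold radiusSq; fun_prop

theorem pd_comp {F : SpaceTime → ℝ} {g : ℝ → ℝ} {g' : ℝ} {p : SpaceTime} {v : SpaceTime}
    (hF : DifferentiableAt ℝ F p) (hg : HasDerivAt g g' (F p)) :
    pd v (fun q => g (F q)) p = g' * pd v F p := by
  have := hg.comp_hasFDerivAt p hF.hasFDerivAt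
  change fderiv ℝ (g ∘ F) p v = _
  rw [this.fderiv]
  simp [pd]

theorem pd_radiusSq_timeDir (p : SpaceTime) : pd timeDir radiusSq p = 0 := by
  unfold radiusSq
  simp (disch := fun_prop) only [pd_add, pd_sq, pd_coord_timeDir]
  simp

theorem pd_radiusSq_spaceDir (i : Fin 2) (p : SpaceTime) :
    pd (spaceDir i) radiusSq p = 2 * p.2 i := by
  unfold radiusSq
  simp (disch := fun_prop) only [pd_add, pd_sq, pd_coord_spaceDir]
  fin_cases i <;> simp

theorem pd_radial {g g' : ℝ → ℝ} (hg' : ∀ s, 0 ≤ s → HasDerivAt g (g' s) s) (i : Fin 2)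
    (p : SpaceTime) :
    pd (spaceDir i) (fun q => g (radiusSq q)) p = g' (radiusSq p) * (2 * p.2 i) := by
  rw [pd_comp (contDiff_radiusSq.differentiable one_ne_zero p) (hg' _ (radiusSq_nonneg p)),
    pd_radiusSq_spaceDir]

/-- Integration by parts against the radial vector field `γ(|x|²) x`. -/
theorem integral_radial_field {W : SpaceTime → ℝ} (hW : ContDiff ℝ 1 W) (hs : SpatiallyBounded W)
    {γ γ' : SpaceTime → ℝ} (hγ : ContDiff ℝ 1 γ)
    (hγ' : ∀ i p, pd (spaceDir i) γ p = γ' p * (2 * p.2 i)) (t : ℝ) :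
    ∫ x, ((γ (t, x) + radiusSq (t, x) * γ' (t, x)) * W (t, x) ^ 2
      + γ (t, x) * W (t, x) * (x 0 * pd (spaceDir 0) W (t, x)
        + x 1 * pd (spaceDir 1) W (t, x))) = 0 := by
  have dW : Differentiable ℝ W := hW.differentiable (by norm_num)
  have dg : Differentiable ℝ γ := hγ.differentiable (by norm_num)
  have b : ∀ i : Fin 2, SpatiallyBounded fun p : SpaceTime =>
      p.2 i * (γ p * W p ^ 2) := fun i => (hs.sq.mul_left _).mul_left _
  have c : ∀ i : Fin 2, ContDiff ℝ 1 fun p : SpaceTime =>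
      p.2 i * (γ p * W p ^ 2) := fun i => by fun_prop
  have h0 := (b 0).integral_pd_spaceDir (c 0) t 0
  have h1 := (b 1).integral_pd_spaceDir (c 1) t 1
  have i0 := ((b 0).directional (spaceDir 0)).integrable (continuous_pd (c 0)) t
  have i1 := ((b 1).directional (spaceDir 1)).integrable (continuous_pd (c 1)) t
  have hsum := integral_add i0 i1
  rw [h0, h1, add_zero] at hsum
  -- The integrand is half the divergence of γ W² x; the coefficient of γ is 1 because div x = 2 in
  -- the plane.
  have : ∀ x : Plane, (γ (t, x) + radiusSq (t, x) * γ' (t, x)) * W (t, x) ^ 2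
      + γ (t, x) * W (t, x) * (x 0 * pd (spaceDir 0) W (t, x)
        + x 1 * pd (spaceDir 1) W (t, x)) =
      (1 / 2) * (pd (spaceDir 0) (fun p : SpaceTime => p.2 0 * (γ p * W p ^ 2)) (t, x)
        + pd (spaceDir 1) (fun p : SpaceTime => p.2 1 * (γ p * W p ^ 2)) (t, x)) := by
    intro x
    simp (disch := fun_prop) only [pd_mul, pd_sq, pd_coord_spaceDir, hγ']
    simp only [radiusSq, if_true]
    ring
  simp only [this]
  rw [integral_const_mul, hsum, mul_zero]

end Coordinates

/-! ### Poincaré and logarithmic Hardy inequalities. -/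

section Poincare

theorem contDiff_inv_one_add_radiusSq : ContDiff ℝ 1 fun p => (1 + radiusSq p)⁻¹ :=
  (contDiff_const.add contDiff_radiusSq).inv fun p => by linarith [radiusSq_nonneg p]

theorem contDiff_log_one_add_radiusSq : ContDiff ℝ 1 fun p => 1 + Real.log (1 + radiusSq p) :=
  contDiff_const.add ((contDiff_const.add contDiff_radiusSq).log
    fun p => by linarith [radiusSq_nonneg p])

theorem pd_inv_one_add_radiusSq (i : Fin 2) (p : SpaceTime) :
    pd (spaceDir i) (fun q => (1 + radiusSq q)⁻¹) p
      = -((1 + radiusSq p)⁻¹ ^ 2) * (2 * p.2 i) := by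
  refine pd_radial (g := fun s => (1 + s)⁻¹) (g' := fun s => -((1 + s)⁻¹ ^ 2)) ?_ i p
  intro s hs
  have := ((hasDerivAt_id s).const_add 1).inv (by simp; linarith)
  convert! this using 1
  simp only [id, inv_pow]
  ring

theorem pd_log_one_add_radiusSq (i : Fin 2) (p : SpaceTime) :
    pd (spaceDir i) (fun q => 1 + Real.log (1 + radiusSq q)) p
      = (1 + radiusSq p)⁻¹ * (2 * p.2 i) := by
  refine pd_radial (g := fun s => 1 + Real.log (1 + s)) (g' := fun s => (1 + s)⁻¹) ?_ i p
  intro s hs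
  have := (((hasDerivAt_id s).const_add 1).log (by simp; linarith)).const_add 1
  convert! this using 1
  simp

variable {W : SpaceTime → ℝ}

/-- Cauchy–Schwarz for the radial derivative. -/
theorem radial_deriv_sq_le (p : SpaceTime) :
    (p.2 0 * pd (spaceDir 0) W p + p.2 1 * pd (spaceDir 1) W p) ^ 2
      ≤ radiusSq p * gradSq W p := by
  simp only [radiusSq, gradSq]
  nlinarith [sq_nonneg (p.2 0 * pd (spaceDir 1) W p - p.2 1 * pd (spaceDir 0) W p)]

/-- The choice γ = (1 + |x|²)⁻¹ makes half of div(γ x) equal to γ², a positive weight. It is the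
origin of the zero-order term in both inequalities below. -/
theorem integral_inv_field (hW : ContDiff ℝ 1 W) (hs : SpatiallyBounded W) (t : ℝ) :
    ∫ x, ((1 + radiusSq (t, x))⁻¹ ^ 2 * W (t, x) ^ 2
      + (1 + radiusSq (t, x))⁻¹ * W (t, x) * (x 0 * pd (spaceDir 0) W (t, x)
        + x 1 * pd (spaceDir 1) W (t, x))) = 0 := by
  rw [← integral_radial_field hW hs contDiff_inv_one_add_radiusSq
    (γ' := fun p => -((1 + radiusSq p)⁻¹ ^ 2)) pd_inv_one_add_radiusSq t]
  refine integral_congr_ae (Eventually.of_forall fun x => ?_)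
  have : (1 + radiusSq (t, x)) * (1 + radiusSq (t, x))⁻¹ = 1 :=
    mul_inv_cancel₀ (by linarith [radiusSq_nonneg (t, x)])
  simp only
  generalize (1 + radiusSq (t, x))⁻¹ = q at *
  generalize radiusSq (t, x) = s at *
  linear_combination (q * W (t, x) ^ 2) * this

/-- The logarithm enlarges the weight: half the divergence is now at least (1 + |x|²)⁻¹ rather than
its square, at the price of a logarithm in the field. -/
theorem integral_log_field (hW : ContDiff ℝ 1 W) (hs : SpatiallyBounded W) (t : ℝ) :
    ∫ x, ((1 + radiusSq (t, x))⁻¹ ^ 2 * (1 + Real.log (1 + radiusSq (t, x)) + radiusSq (t, x))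
        * W (t, x) ^ 2
      + (1 + Real.log (1 + radiusSq (t, x))) * (1 + radiusSq (t, x))⁻¹ * W (t, x)
        * (x 0 * pd (spaceDir 0) W (t, x) + x 1 * pd (spaceDir 1) W (t, x))) = 0 := by
  have c1 := contDiff_inv_one_add_radiusSq
  have c2 := contDiff_log_one_add_radiusSq
  rw [← integral_radial_field hW hs (c2.mul c1)
    (γ' := fun p => (1 + radiusSq p)⁻¹ ^ 2
      - (1 + Real.log (1 + radiusSq p)) * (1 + radiusSq p)⁻¹ ^ 2) ?_ t]
  · refine integral_congr_ae (Eventually.of_forall fun x => ?_)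
    have : (1 + radiusSq (t, x)) * (1 + radiusSq (t, x))⁻¹ = 1 :=
      mul_inv_cancel₀ (by linarith [radiusSq_nonneg (t, x)])
    simp only
    generalize Real.log (1 + radiusSq (t, x)) = l at *
    generalize (1 + radiusSq (t, x))⁻¹ = q at *
    generalize radiusSq (t, x) = s at *
    linear_combination ((1 + l) * q * W (t, x) ^ 2) * this
  · intro i p
    rw [pd_mul (c2.differentiable one_ne_zero) (c1.differentiable one_ne_zero),
      pd_log_one_add_radiusSq, pd_inv_one_add_radiusSq]
    ring

theorem continuous_gradSq (hW : ContDiff ℝ 1 W) : Continuous (gradSq W) :=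
  ((continuous_pd hW).pow 2).add ((continuous_pd hW).pow 2)

/-- A Poincaré inequality in which the zero-order term is only seen far from the origin. -/
theorem exists_integral_sq_le {a : Plane → ℝ} {L ε₀ : ℝ} (ha : Continuous a)
    (ha_nonneg : ∀ x, 0 ≤ a x) (hL : 0 < L) (hε₀ : 0 < ε₀) (ha_far : ∀ x, L < ‖x‖ → ε₀ ≤ a x) :
    ∃ C, 0 < C ∧ ∀ W : SpaceTime → ℝ, ContDiff ℝ 1 W → SpatiallyBounded W → ∀ t,
      ∫ x, W (t, x) ^ 2 ≤ C * ((∫ x, gradSq W (t, x)) + ∫ x, a x * W (t, x) ^ 2) := by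
  set K : ℝ := 2 * (1 + L ^ 2) ^ 2 with hK
  have hK0 : 0 < K := by positivity
  -- K makes K/2 times the weight (1 + |x|²)⁻² at least 1 on the ball of radius L. The three
  -- summands then absorb the gradient inside the ball, the gradient outside it, and W² outside it
  -- through a ≥ ε₀.
  refine ⟨K * L ^ 2 / 2 + K / 2 + (1 + K / 2) / ε₀, by positivity, fun W hW hs t => ?_⟩
  set C : ℝ := K * L ^ 2 / 2 + K / 2 + (1 + K / 2) / ε₀ with hC
  have hC1 : K * L ^ 2 / 2 ≤ C := by
    have : 0 ≤ K / 2 + (1 + K / 2) / ε₀ := by positivity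
    linarith
  have hC2 : K / 2 ≤ C := by
    have : 0 ≤ K * L ^ 2 / 2 + (1 + K / 2) / ε₀ := by positivity
    linarith
  have hC3 : 1 + K / 2 ≤ C * ε₀ := by
    have h1 : (1 + K / 2) / ε₀ ≤ C := by
      have : 0 ≤ K * L ^ 2 / 2 + K / 2 := by positivity
      linarith
    rwa [div_le_iff₀ hε₀] at h1
  have hWc := hW.continuous
  have iW : Integrable fun x => W (t, x) ^ 2 := hs.sq.integrable (by fun_prop) t
  have iG : Integrable fun x => gradSq W (t, x) := hs.gradSq.integrable (continuous_gradSq hW) t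
  have iA : Integrable fun x => a x * W (t, x) ^ 2 :=
    (hs.sq.mul_left fun p => a p.2).integrable (by fun_prop) t
  have hcI : Continuous fun p : SpaceTime => (1 + radiusSq p)⁻¹ ^ 2 * W p ^ 2
      + (1 + radiusSq p)⁻¹ * W p * (p.2 0 * pd (spaceDir 0) W p
        + p.2 1 * pd (spaceDir 1) W p) := by
    have h1 := contDiff_inv_one_add_radiusSq.continuous
    have h2 := continuous_pd (v := spaceDir 0) hW
    have h3 := continuous_pd (v := spaceDir 1) hW
    fun_prop
  have iI := ((hs.sq.mul_left fun p => (1 + radiusSq p)⁻¹ ^ 2).add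
    ((hs.mul_left fun p => (1 + radiusSq p)⁻¹).mul_right _)).integrable hcI t
  have hI := integral_inv_field hW hs t
  -- K times an integrand of zero integral is added, which reduces the inequality to a pointwise
  -- one.
  have key : ∫ x, W (t, x) ^ 2 ≤ ∫ x, (C * (gradSq W (t, x) + a x * W (t, x) ^ 2)
      + K * ((1 + radiusSq (t, x))⁻¹ ^ 2 * W (t, x) ^ 2
      + (1 + radiusSq (t, x))⁻¹ * W (t, x) * (x 0 * pd (spaceDir 0) W (t, x)
        + x 1 * pd (spaceDir 1) W (t, x)))) := by
    refine integral_mono iW (((iG.add iA).const_mul C).add (iI.const_mul K)) fun x => ?_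
    have hcs := radial_deriv_sq_le (W := W) (t, x)
    have hG := gradSq_nonneg (W := W) (t, x)
    have hs0 := radiusSq_nonneg (t, x)
    have hsx : radiusSq (t, x) = ‖x‖ ^ 2 := radiusSq_eq (t, x)
    have hq : (1 + radiusSq (t, x)) * (1 + radiusSq (t, x))⁻¹ = 1 :=
      mul_inv_cancel₀ (by linarith)
    have hq0 : 0 ≤ (1 + radiusSq (t, x))⁻¹ := inv_nonneg.2 (by linarith)
    have hax := ha_nonneg x
    simp only
    simp only at hcs
    generalize x 0 * pd (spaceDir 0) W (t, x) + x 1 * pd (spaceDir 1) W (t, x) = D at *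
    generalize gradSq W (t, x) = G at *
    generalize (1 + radiusSq (t, x))⁻¹ = q at *
    generalize W (t, x) = w at *
    generalize radiusSq (t, x) = s at *
    rcases le_or_gt ‖x‖ L with h | h
    · have hsL : s ≤ L ^ 2 := by
        rw [hsx]; exact pow_le_pow_left₀ (norm_nonneg _) h 2
      have h1 : 1 ≤ (1 + L ^ 2) * q := by nlinarith
      have h2 : 1 ≤ ((1 + L ^ 2) * q) ^ 2 := one_le_pow₀ h1
      have h3 : w ^ 2 ≤ K / 2 * (q ^ 2 * w ^ 2) := by
        have := mul_le_mul_of_nonneg_right h2 (sq_nonneg w)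
        calc w ^ 2 = 1 * w ^ 2 := by ring
          _ ≤ _ := this
          _ = _ := by rw [hK]; ring
      have h4 : D ^ 2 ≤ L ^ 2 * G := hcs.trans (mul_le_mul_of_nonneg_right hsL hG)
      have h5 : 0 ≤ q ^ 2 * w ^ 2 + 2 * (q * w * D) + D ^ 2 := by
        have := sq_nonneg (q * w + D); nlinarith
      have h6 : K * L ^ 2 / 2 * G ≤ C * G := mul_le_mul_of_nonneg_right hC1 hG
      have h7 : 0 ≤ C * (a x * w ^ 2) := by positivity
      have h8 := mul_le_mul_of_nonneg_left h4 hK0.le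
      have h9 := mul_nonneg hK0.le h5
      nlinarith
    · have hae := ha_far x h
      have h1 : (q * D) ^ 2 ≤ G := by
        have : q ^ 2 * s ≤ 1 := by nlinarith
        calc (q * D) ^ 2 = q ^ 2 * D ^ 2 := by ring
          _ ≤ q ^ 2 * (s * G) := mul_le_mul_of_nonneg_left hcs (sq_nonneg q)
          _ = q ^ 2 * s * G := by ring
          _ ≤ 1 * G := mul_le_mul_of_nonneg_right this hG
          _ = G := one_mul G
      have h2 : 0 ≤ w ^ 2 + 2 * (q * w * D) + (q * D) ^ 2 := by
        have := sq_nonneg (w + q * D); nlinarith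
      have h3 : (1 + K / 2) * w ^ 2 ≤ C * (a x * w ^ 2) := by
        calc (1 + K / 2) * w ^ 2 ≤ C * ε₀ * w ^ 2 := mul_le_mul_of_nonneg_right hC3 (sq_nonneg w)
          _ ≤ C * (a x * w ^ 2) := by
            rw [mul_assoc]
            exact mul_le_mul_of_nonneg_left (mul_le_mul_of_nonneg_right hae (sq_nonneg w))
              (le_trans (by positivity) hC2)
      have h4 : K / 2 * G ≤ C * G := mul_le_mul_of_nonneg_right hC2 hG
      have h5 : 0 ≤ K * (q ^ 2 * w ^ 2) := by positivity
      have h8 := mul_le_mul_of_nonneg_left h1 hK0.le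
      have h9 := mul_nonneg hK0.le h2
      nlinarith
  have hsplit := integral_add ((iG.add iA).const_mul C) (iI.const_mul K)
  simp only [Pi.add_apply] at hsplit
  rw [hsplit, integral_const_mul, integral_const_mul, hI, integral_add iG iA] at key
  simpa using key

/-- The planar Hardy-type inequality with logarithmic loss in the radius of the support. -/
theorem integral_weighted_sq_le {ρ : ℝ} (hW : ContDiff ℝ 1 W) (hρ : 0 ≤ ρ)
    (hs : ∀ p : SpaceTime, ρ + |p.1| < ‖p.2‖ → W p = 0) (t : ℝ) :
    ∫ x, (1 + radiusSq (t, x))⁻¹ ^ 2 * W (t, x) ^ 2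
      ≤ (1 + Real.log (1 + (ρ + |t|) ^ 2)) * ∫ x, gradSq W (t, x) := by
  have hsb : SpatiallyBounded W := ⟨ρ, hρ, hs⟩
  set A : ℝ := 1 + Real.log (1 + (ρ + |t|) ^ 2) with hA
  have hA1 : 1 ≤ A := by
    have : 0 ≤ Real.log (1 + (ρ + |t|) ^ 2) := Real.log_nonneg (by nlinarith [sq_nonneg (ρ + |t|)])
    linarith
  have hWc := hW.continuous
  have h1 := contDiff_inv_one_add_radiusSq.continuous
  have h2 := continuous_pd (v := spaceDir 0) hW
  have h3 := continuous_pd (v := spaceDir 1) hW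
  have h4 := contDiff_log_one_add_radiusSq.continuous
  have h5 : Continuous radiusSq := (contDiff_radiusSq (n := 1)).continuous
  have iW : Integrable fun x => (1 + radiusSq (t, x))⁻¹ ^ 2 * W (t, x) ^ 2 :=
    (hsb.sq.mul_left fun p => (1 + radiusSq p)⁻¹ ^ 2).integrable (by fun_prop) t
  have iG : Integrable fun x => gradSq W (t, x) := hsb.gradSq.integrable (continuous_gradSq hW) t
  have iI := ((hsb.sq.mul_left fun p => (1 + radiusSq p)⁻¹ ^ 2).add
    ((hsb.mul_left fun p => (1 + radiusSq p)⁻¹).mul_right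
      fun p => p.2 0 * pd (spaceDir 0) W p + p.2 1 * pd (spaceDir 1) W p)).integrable
    (by fun_prop) t
  have iJ := ((hsb.sq.mul_left fun p => (1 + radiusSq p)⁻¹ ^ 2
      * (1 + Real.log (1 + radiusSq p) + radiusSq p)).add
    ((hsb.mul_left fun p => (1 + Real.log (1 + radiusSq p)) * (1 + radiusSq p)⁻¹).mul_right
      fun p => p.2 0 * pd (spaceDir 0) W p + p.2 1 * pd (spaceDir 1) W p)).integrable
    (by fun_prop) t
  have hI := integral_inv_field hW hsb t
  have hJ := integral_log_field hW hsb t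
  -- Both divergence identities are added, the logarithmic one with factor A⁻¹. Alone that one
  -- bounds ∫ W²/(1 + |x|²) with a loss A²; the factor A⁻¹ reduces the loss to A, which balances the
  -- Young inequality used in the other.
  have key := integral_mono iW ((iI.add (iJ.const_mul A⁻¹)).add (iG.const_mul A)) fun x => by
    have hcs := radial_deriv_sq_le (W := W) (t, x)
    have hG := gradSq_nonneg (W := W) (t, x)
    have hs0 := radiusSq_nonneg (t, x)
    have hsx : radiusSq (t, x) = ‖x‖ ^ 2 := radiusSq_eq (t, x)
    have hq : (1 + radiusSq (t, x)) * (1 + radiusSq (t, x))⁻¹ = 1 :=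
      mul_inv_cancel₀ (by linarith)
    have hq0 : 0 < (1 + radiusSq (t, x))⁻¹ := inv_pos.2 (by linarith)
    have hl0 : 0 ≤ Real.log (1 + radiusSq (t, x)) := Real.log_nonneg (by linarith)
    simp only [Pi.add_apply]
    -- The bound 1 + log(1 + |x|²) ≤ A holds only on the support of W; elsewhere the zero-order
    -- terms vanish.
    by_cases hw : W (t, x) = 0
    · simp only [hw]
      have : 0 ≤ A * gradSq W (t, x) := by positivity
      simpa using this
    have hlA : 1 + Real.log (1 + radiusSq (t, x)) ≤ A := by
      have hx : ‖x‖ ≤ ρ + |t| := by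
        by_contra hcon
        exact hw (hs (t, x) (not_le.1 hcon))
      have : Real.log (1 + radiusSq (t, x)) ≤ Real.log (1 + (ρ + |t|) ^ 2) := by
        refine Real.log_le_log (by linarith) ?_
        rw [hsx]
        linarith [pow_le_pow_left₀ (norm_nonneg x) hx 2]
      linarith
    simp only at hcs
    generalize x 0 * pd (spaceDir 0) W (t, x) + x 1 * pd (spaceDir 1) W (t, x) = D at *
    generalize gradSq W (t, x) = G at *
    generalize Real.log (1 + radiusSq (t, x)) = l at *
    generalize (1 + radiusSq (t, x))⁻¹ = q at *
    generalize W (t, x) = w at *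
    generalize radiusSq (t, x) = s at *
    have hqD : q * D ^ 2 ≤ G := by
      calc q * D ^ 2 ≤ q * (s * G) := mul_le_mul_of_nonneg_left hcs hq0.le
        _ = (q * s) * G := by ring
        _ ≤ 1 * G := mul_le_mul_of_nonneg_right (by nlinarith) hG
        _ = G := one_mul G
    have hA0 : 0 < A := by linarith
    have e1 : A⁻¹ * (q * w ^ 2) / 2
        ≤ A⁻¹ * (q ^ 2 * (1 + l + s) * w ^ 2 + (1 + l) * q * w * D) + A * G / 2 := by
      have f1 : q * w ^ 2 ≤ q ^ 2 * (1 + l + s) * w ^ 2 := by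
        refine mul_le_mul_of_nonneg_right ?_ (sq_nonneg w)
        nlinarith [mul_nonneg (sq_nonneg q) hl0]
      have f2 : 0 ≤ q * (w + (1 + l) * D) ^ 2 := by positivity
      have f3 : (1 + l) ^ 2 * (q * D ^ 2) ≤ A ^ 2 * G := by
        gcongr
      have f4 : q * w ^ 2 / 2 ≤ q ^ 2 * (1 + l + s) * w ^ 2 + (1 + l) * q * w * D
          + A ^ 2 * G / 2 := by nlinarith
      calc A⁻¹ * (q * w ^ 2) / 2 = A⁻¹ * (q * w ^ 2 / 2) := by ring
        _ ≤ A⁻¹ * (q ^ 2 * (1 + l + s) * w ^ 2 + (1 + l) * q * w * D + A ^ 2 * G / 2) :=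
          mul_le_mul_of_nonneg_left f4 (inv_nonneg.2 hA0.le)
        _ = _ := by field_simp
    have e2 : q ^ 2 * w ^ 2 ≤ q ^ 2 * w ^ 2 + q * w * D + A⁻¹ * (q * w ^ 2) / 2 + A * G / 2 := by
      have f2 : 0 ≤ A⁻¹ * q * (w + A * D) ^ 2 := by positivity
      have f3 : A⁻¹ * q * (w + A * D) ^ 2
          = A⁻¹ * (q * w ^ 2) + 2 * (q * w * D) + A * (q * D ^ 2) := by field_simp; ring
      have f4 := mul_le_mul_of_nonneg_left hqD hA0.le
      linarith
    linarith
  have hsplit1 := integral_add (iI.add (iJ.const_mul A⁻¹)) (iG.const_mul A)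
  have hsplit2 := integral_add iI (iJ.const_mul A⁻¹)
  simp only [Pi.add_apply] at hsplit1 hsplit2 key
  rw [hsplit1, hsplit2, integral_const_mul, integral_const_mul, hI, hJ] at key
  simpa using key

end Poincare

/-! ### The Morawetz identity. -/

section Morawetz

/-- The profile of the radial multiplier: `multiplier L` times `x` is bounded by `L`. -/
def multiplier (L : ℝ) (p : SpaceTime) : ℝ := (√(1 + radiusSq p / L ^ 2))⁻¹

theorem one_add_radiusSq_div_pos (L : ℝ) (p : SpaceTime) : 0 < 1 + radiusSq p / L ^ 2 := by
  have := div_nonneg (radiusSq_nonneg p) (sq_nonneg L)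
  linarith

theorem contDiff_multiplier (L : ℝ) : ContDiff ℝ 1 (multiplier L) := by
  unfold multiplier
  exact ((contDiff_const.add (contDiff_radiusSq.div_const _)).sqrt
    fun p => (one_add_radiusSq_div_pos L p).ne').inv
    fun p => (Real.sqrt_pos.2 (one_add_radiusSq_div_pos L p)).ne'

theorem multiplier_pos (L : ℝ) (p : SpaceTime) : 0 < multiplier L p :=
  inv_pos.2 (Real.sqrt_pos.2 (one_add_radiusSq_div_pos L p))

theorem multiplier_sq (L : ℝ) (p : SpaceTime) :
    multiplier L p ^ 2 * (1 + radiusSq p / L ^ 2) = 1 := by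
  rw [multiplier, inv_pow, Real.sq_sqrt (one_add_radiusSq_div_pos L p).le]
  exact inv_mul_cancel₀ (one_add_radiusSq_div_pos L p).ne'

theorem pd_multiplier_spaceDir (L : ℝ) (i : Fin 2) (p : SpaceTime) :
    pd (spaceDir i) (multiplier L) p
      = -(multiplier L p ^ 3 / (2 * L ^ 2)) * (2 * p.2 i) := by
  refine pd_radial (g := fun s => (√(1 + s / L ^ 2))⁻¹)
    (g' := fun s => -((√(1 + s / L ^ 2))⁻¹ ^ 3 / (2 * L ^ 2))) ?_ i p
  intro s hs
  have h0 : 0 < 1 + s / L ^ 2 := by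
    have := div_nonneg hs (sq_nonneg L)
    linarith
  have hr : √(1 + s / L ^ 2) ≠ 0 := (Real.sqrt_pos.2 h0).ne'
  have := ((((hasDerivAt_id s).div_const (L ^ 2)).const_add 1).sqrt (by simpa using h0.ne')).inv
    (by simpa using hr)
  convert! this using 1
  simp only [id]
  rw [inv_pow]
  by_cases hL : L = 0
  · simp [hL]
  · field_simp

theorem pd_multiplier_timeDir (L : ℝ) (p : SpaceTime) : pd timeDir (multiplier L) p = 0 := by
  have h0 := one_add_radiusSq_div_pos L p
  have h1 := (((hasDerivAt_id (radiusSq p)).div_const (L ^ 2)).const_add 1).sqrt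
    (by simpa using h0.ne')
  have := h1.inv (by simpa using (Real.sqrt_pos.2 h0).ne')
  have h2 := pd_comp (v := timeDir) (contDiff_radiusSq.differentiable one_ne_zero p) this
  rw [pd_radiusSq_timeDir, mul_zero] at h2
  exact h2

/-- The derivative along `x`, that is `x · ∇W`. -/
def radialDeriv (W : SpaceTime → ℝ) (p : SpaceTime) : ℝ :=
  p.2 0 * pd (spaceDir 0) W p + p.2 1 * pd (spaceDir 1) W p

/-- The density whose integral is the Morawetz functional. -/
def morawetzDensity (L : ℝ) (a : Plane → ℝ) (W : SpaceTime → ℝ) (p : SpaceTime) : ℝ :=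
  multiplier L p * radialDeriv W p * pd timeDir W p + 1 / 3 * (W p * pd timeDir W p)
    + 1 / 6 * (a p.2 * W p ^ 2)

variable {a : Plane → ℝ} {W : SpaceTime → ℝ} {L : ℝ}

theorem contDiff_radialDeriv (hW : ContDiff ℝ 2 W) : ContDiff ℝ 1 (radialDeriv W) := by
  have c0 := contDiff_one_pd (v := spaceDir 0) hW
  have c1 := contDiff_one_pd (v := spaceDir 1) hW
  unfold radialDeriv
  fun_prop

theorem contDiff_morawetzDensity (ha : ContDiff ℝ 2 a) (hW : ContDiff ℝ 2 W) :
    ContDiff ℝ 1 (morawetzDensity L a W) := by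
  have c0 := contDiff_one_pd (v := timeDir) hW
  have c1 := contDiff_radialDeriv hW
  have c2 := contDiff_multiplier L
  have ha' : ContDiff ℝ 1 a := ha.of_le (by norm_num)
  have hW' : ContDiff ℝ 1 W := hW.of_le (by norm_num)
  unfold morawetzDensity
  fun_prop

theorem SpatiallyBounded.morawetzDensity (hs : SpatiallyBounded W) (L : ℝ) (a : Plane → ℝ) :
    SpatiallyBounded (morawetzDensity L a W) :=
  ((((hs.directional timeDir).mul_left fun p => multiplier L p * radialDeriv W p)).add
    ((hs.mul_right (pd timeDir W)).mul_left fun _ => 1 / 3)).add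
    ((hs.sq.mul_left fun p => a p.2).mul_left fun _ => 1 / 6)

/-- Obtained by multiplying the equation by m x·∇W + W/3, with m the multiplier. The term a W²/6 in
the density has time derivative a W W_t / 3, so the damping does not contribute through the W/3
part. The factor in front of |∇W|² - W_t² is half the divergence of m x. -/
theorem hasDerivAt_morawetz (ha : ContDiff ℝ 2 a) (hW : ContDiff ℝ 2 W)
    (hs : SpatiallyBounded W) (t : ℝ) :
    HasDerivAt (fun s => ∫ x, morawetzDensity L a W (s, x))
      (∫ x, ((multiplier L (t, x) * radialDeriv W (t, x) + 1 / 3 * W (t, x))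
          * (dalembert W (t, x) + a x * pd timeDir W (t, x))
        - a x * pd timeDir W (t, x) * (multiplier L (t, x) * radialDeriv W (t, x))
        - multiplier L (t, x) * gradSq W (t, x)
        + multiplier L (t, x) ^ 3 / L ^ 2 * radialDeriv W (t, x) ^ 2
        + (multiplier L (t, x) - multiplier L (t, x) ^ 3 * radiusSq (t, x) / (2 * L ^ 2))
          * (gradSq W (t, x) - pd timeDir W (t, x) ^ 2)
        + 1 / 3 * (pd timeDir W (t, x) ^ 2 - gradSq W (t, x)))) t := by
  have c : ∀ v, ContDiff ℝ 1 (pd v W) := fun v => contDiff_one_pd hW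
  have d : ∀ v, Differentiable ℝ (pd v W) := fun v => (c v).differentiable (by norm_num)
  have ct := c timeDir
  have c0 := c (spaceDir 0)
  have c1 := c (spaceDir 1)
  have dt := d timeDir
  have d0 := d (spaceDir 0)
  have d1 := d (spaceDir 1)
  have cm := contDiff_multiplier L
  have dm : Differentiable ℝ (multiplier L) := cm.differentiable (by norm_num)
  have ha' : ContDiff ℝ 1 a := ha.of_le (by norm_num)
  have da : Differentiable ℝ a := ha'.differentiable (by norm_num)
  have hW' : ContDiff ℝ 1 W := hW.of_le (by norm_num)
  have dW : Differentiable ℝ W := hW'.differentiable (by norm_num)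
  have bt := hs.directional timeDir
  have b0 := hs.directional (spaceDir 0)
  have b1 := hs.directional (spaceDir 1)
  have key := hasDerivAt_integral_of_flux (F := fun p => multiplier L p *
      (p.2 0 * pd (spaceDir 0) W p + p.2 1 * pd (spaceDir 1) W p) * pd timeDir W p
      + 1 / 3 * (W p * pd timeDir W p) + 1 / 6 * (a p.2 * W p ^ 2))
    (J₀ := fun p => multiplier L p *
      (p.2 0 * pd (spaceDir 0) W p + p.2 1 * pd (spaceDir 1) W p) * pd (spaceDir 0) W p
      + (1 / 2 * (multiplier L p * p.2 0)) *
        (pd timeDir W p ^ 2 - (pd (spaceDir 0) W p ^ 2 + pd (spaceDir 1) W p ^ 2))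
      + 1 / 3 * (W p * pd (spaceDir 0) W p))
    (J₁ := fun p => multiplier L p *
      (p.2 0 * pd (spaceDir 0) W p + p.2 1 * pd (spaceDir 1) W p) * pd (spaceDir 1) W p
      + (1 / 2 * (multiplier L p * p.2 1)) *
        (pd timeDir W p ^ 2 - (pd (spaceDir 0) W p ^ 2 + pd (spaceDir 1) W p ^ 2))
      + 1 / 3 * (W p * pd (spaceDir 1) W p))
    (hs.morawetzDensity L a)
    (((b0.mul_left _).add ((bt.sq.sub (b0.sq.add b1.sq)).mul_left _)).add
      ((hs.mul_right _).mul_left fun _ => 1 / 3))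
    (((b1.mul_left _).add ((bt.sq.sub (b0.sq.add b1.sq)).mul_left _)).add
      ((hs.mul_right _).mul_left fun _ => 1 / 3))
    (by fun_prop) (by fun_prop) (by fun_prop) t
  refine key.congr_deriv (integral_congr_ae (Eventually.of_forall fun x => ?_))
  have hpa : pd timeDir (fun q => a q.2) (t, x) = 0 := pd_timeDir_comp_snd da _
  simp (disch := fun_prop) only [pd_add, pd_sub, pd_mul, pd_sq, pd_const, hpa,
    pd_multiplier_timeDir, pd_multiplier_spaceDir, pd_coord_timeDir, pd_coord_spaceDir]
  rw [pd_comm hW timeDir (spaceDir 0), pd_comm hW timeDir (spaceDir 1),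
    pd_comm hW (spaceDir 0) (spaceDir 1)]
  simp only [gradSq, dalembert, radialDeriv, radiusSq]
  simp only [if_true, one_ne_zero, zero_ne_one, if_false]
  ring

end Morawetz

/-! ### Decay from the Lyapunov functional. -/

section Lyapunov

/-- Decay from a Lyapunov functional: `(t + α) X + (c / 2) t² E + β B` is nonincreasing. -/
theorem decay_of_lyapunov {E D N A X X' B Λ : ℝ → ℝ} {c c₁ C₁ C₂ : ℝ} (hc : 0 < c)
    (hc₁ : 0 < c₁) (hC₁ : 0 < C₁) (hC₂ : 0 < C₂)
    (hE : ∀ t, 1 ≤ t → HasDerivAt E (-2 * D t) t) (hX : ∀ t, 1 ≤ t → HasDerivAt X (X' t) t)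
    (hB : ∀ t, 1 ≤ t → HasDerivAt B (-A t) t) (hE0 : ∀ t, 0 ≤ E t) (hN0 : ∀ t, 0 ≤ N t)
    (hD0 : ∀ t, 0 ≤ D t) (hX' : ∀ t, 1 ≤ t → X' t ≤ -c * E t)
    (hN : ∀ t, N t ≤ C₂ * (E t + A t)) (hXl : ∀ t, c₁ * (E t + N t) ≤ X t)
    (hXu : ∀ t, X t ≤ C₁ * (E t + N t)) (hBl : ∀ t, 1 ≤ t → -Λ t ≤ B t)
    {C₃ : ℝ} (hΛ : ∀ t, 2 ≤ t → Λ t ≤ C₃ * Real.log t) :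
    ∃ K, ∀ t, 2 ≤ t → N t ≤ K * (t⁻¹ * Real.log t) ∧ E t ≤ K * ((t ^ 2)⁻¹ * Real.log t) := by
  -- In Y' the term X is at most C₁ E + C₁ N ≤ (C₁ + C₁ C₂) E + C₁ C₂ A; α c E and β A cancel
  -- exactly these. The coefficient c/2 of t² E is chosen so that its derivative c t E cancels t X'
  -- ≤ -c t E.
  set α : ℝ := (C₁ + C₁ * C₂) / c with hα
  set β : ℝ := C₁ * C₂ with hβ
  have hα0 : 0 < α := by positivity
  have hβ0 : 0 < β := by positivity
  set Y : ℝ → ℝ := fun t => (t + α) * X t + β * B t + c / 2 * (t ^ 2 * E t) with hY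
  have hYd : ∀ t, 1 ≤ t → HasDerivAt Y ((1 * X t + (t + α) * X' t) + β * (-A t)
      + c / 2 * (2 * t * E t + t ^ 2 * (-2 * D t))) t := by
    intro t ht
    have h2 : HasDerivAt (fun s : ℝ => s ^ 2) (2 * t) t := by simpa using hasDerivAt_pow 2 t
    exact ((((hasDerivAt_id t).add_const α).mul (hX t ht)).add ((hB t ht).const_mul β)).add
      ((h2.mul (hE t ht)).const_mul (c / 2))
  have hanti : AntitoneOn Y (Ici 1) := by
    refine antitoneOn_of_deriv_nonpos (convex_Ici 1)
      (fun t ht => (hYd t ht).continuousAt.continuousWithinAt) ?_ ?_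
    · intro t ht
      rw [interior_Ici] at ht
      exact (hYd t (le_of_lt ht)).differentiableAt.differentiableWithinAt
    · intro t ht
      rw [interior_Ici] at ht
      have ht1 : 1 ≤ t := le_of_lt ht
      rw [(hYd t ht1).deriv]
      have e1 : (t + α) * X' t ≤ (t + α) * (-c * E t) :=
        mul_le_mul_of_nonneg_left (hX' t ht1) (by linarith)
      have e2 : α * c = C₁ + C₁ * C₂ := div_mul_cancel₀ _ hc.ne'
      have e3 := mul_le_mul_of_nonneg_left (hN t) hC₁.le
      have e4 := hXu t
      have e5 : 0 ≤ c * (t ^ 2 * D t) := by have := hD0 t; positivity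
      have e6 : (t + α) * (-c * E t) = -c * t * E t - (C₁ + C₁ * C₂) * E t := by
        rw [← e2]; ring
      rw [hβ]
      nlinarith
  have hlog2 : 0 < Real.log 2 := Real.log_pos (by norm_num)
  set K₀ : ℝ := |Y 1| / Real.log 2 + β * C₃ with hK₀
  have main : ∀ t, 2 ≤ t → (t + α) * X t + c / 2 * (t ^ 2 * E t) ≤ K₀ * Real.log t := by
    intro t ht
    have h1 : Y t ≤ Y 1 := hanti (mem_Ici.2 le_rfl) (mem_Ici.2 (by linarith)) (by linarith)
    have h2 := mul_le_mul_of_nonneg_left (hBl t (by linarith)) hβ0.le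
    have h3 := mul_le_mul_of_nonneg_left (hΛ t ht) hβ0.le
    have hlog : Real.log 2 ≤ Real.log t := Real.log_le_log (by norm_num) ht
    have h4 : |Y 1| ≤ |Y 1| / Real.log 2 * Real.log t := by
      rw [div_mul_eq_mul_div, le_div_iff₀ hlog2]
      exact mul_le_mul_of_nonneg_left hlog (abs_nonneg _)
    have h5 := le_abs_self (Y 1)
    have h6 : Y t = (t + α) * X t + β * B t + c / 2 * (t ^ 2 * E t) := rfl
    rw [hK₀, add_mul]
    linarith
  refine ⟨max (K₀ / c₁) (K₀ / (c / 2)), fun t ht => ?_⟩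
  have ht0 : 0 < t := by linarith
  have hlog : 0 ≤ Real.log t := Real.log_nonneg (by linarith)
  have hE := hE0 t
  have hN := hN0 t
  have hX0 : 0 ≤ X t := le_trans (by positivity) (hXl t)
  have m := main t ht
  have p1 : 0 ≤ α * X t := by positivity
  have p2 : 0 ≤ c / 2 * (t ^ 2 * E t) := by positivity
  constructor
  · have h1 : c₁ * N t ≤ X t := le_trans (by nlinarith) (hXl t)
    have h2 : t * (c₁ * N t) ≤ K₀ * Real.log t := by
      have := mul_le_mul_of_nonneg_left h1 ht0.le
      nlinarith
    have h3 : N t ≤ K₀ / c₁ * (t⁻¹ * Real.log t) := by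
      have : N t = (t * (c₁ * N t)) / (t * c₁) := by field_simp
      rw [this, div_le_iff₀ (by positivity)]
      calc t * (c₁ * N t) ≤ K₀ * Real.log t := h2
        _ = _ := by field_simp
    exact h3.trans (mul_le_mul_of_nonneg_right (le_max_left _ _) (by positivity))
  · have h2 : c / 2 * (t ^ 2 * E t) ≤ K₀ * Real.log t := by
      have : 0 ≤ t * X t := by positivity
      nlinarith
    have h3 : E t ≤ K₀ / (c / 2) * ((t ^ 2)⁻¹ * Real.log t) := by
      have : E t = (c / 2 * (t ^ 2 * E t)) / (c / 2 * t ^ 2) := by field_simp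
      rw [this, div_le_iff₀ (by positivity)]
      calc c / 2 * (t ^ 2 * E t) ≤ K₀ * Real.log t := h2
        _ = _ := by field_simp
    exact h3.trans (mul_le_mul_of_nonneg_right (le_max_right _ _) (by positivity))

/-- The logarithm of the radius of the support grows like `log t`. -/
theorem one_add_log_radius_le {ρ t : ℝ} (hρ : 0 ≤ ρ) (ht : 2 ≤ t) :
    1 + Real.log (1 + (ρ + |t|) ^ 2)
      ≤ ((1 + Real.log (1 + (ρ + 1) ^ 2)) / Real.log 2 + 2) * Real.log t := by
  have ht0 : 0 < t := by linarith
  rw [abs_of_pos ht0]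
  have hlog2 : 0 < Real.log 2 := Real.log_pos (by norm_num)
  have hlog : Real.log 2 ≤ Real.log t := Real.log_le_log (by norm_num) ht
  have h1 : Real.log (1 + (ρ + t) ^ 2) ≤ Real.log ((1 + (ρ + 1) ^ 2) * t ^ 2) := by
    refine Real.log_le_log (by positivity) ?_
    -- Factoring out t bounds the logarithm by a constant plus 2 log t; the constant is absorbed
    -- since log t ≥ log 2.
    have h2 : ρ + t ≤ (ρ + 1) * t := by nlinarith
    have h3 := pow_le_pow_left₀ (by linarith) h2 2
    have h4 : 1 ≤ t ^ 2 := one_le_pow₀ (by linarith)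
    nlinarith
  rw [Real.log_mul (by positivity) (by positivity), Real.log_pow] at h1
  have h0 : 0 ≤ Real.log (1 + (ρ + 1) ^ 2) :=
    Real.log_nonneg (by nlinarith [sq_nonneg (ρ + 1)])
  have h5 : 1 + Real.log (1 + (ρ + 1) ^ 2)
      ≤ (1 + Real.log (1 + (ρ + 1) ^ 2)) / Real.log 2 * Real.log t := by
    rw [div_mul_eq_mul_div, le_div_iff₀ hlog2]
    exact mul_le_mul_of_nonneg_left hlog (by linarith)
  rw [add_mul]
  push_cast at h1
  linarith

end Lyapunov

/-! ### Pointwise bounds for the Morawetz multiplier. -/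

section MorawetzBounds

variable {a : Plane → ℝ} {W : SpaceTime → ℝ} {L M ε₀ : ℝ}

theorem multiplier_le_one (L : ℝ) (p : SpaceTime) : multiplier L p ≤ 1 := by
  have h1 := multiplier_sq L p
  have h2 := multiplier_pos L p
  have h3 : 0 ≤ radiusSq p / L ^ 2 := div_nonneg (radiusSq_nonneg p) (sq_nonneg L)
  nlinarith [mul_nonneg (sq_nonneg (multiplier L p)) h3]

/-- Eliminates |x|² in favour of the multiplier m; every coefficient in the Morawetz integrand thus
becomes a polynomial in m on (0, 1]. -/
theorem multiplier_sq_mul_radiusSq (hL : 0 < L) (p : SpaceTime) :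
    multiplier L p ^ 2 * radiusSq p = L ^ 2 * (1 - multiplier L p ^ 2) := by
  have h1 := multiplier_sq L p
  have h2 : multiplier L p ^ 2 * (1 + radiusSq p / L ^ 2) * L ^ 2
      = multiplier L p ^ 2 * L ^ 2 + multiplier L p ^ 2 * radiusSq p := by
    field_simp
  rw [h1] at h2
  linarith

theorem multiplier_radialDeriv_sq_le (hL : 0 < L) (p : SpaceTime) :
    (multiplier L p * radialDeriv W p) ^ 2 ≤ L ^ 2 * gradSq W p := by
  have h1 := radial_deriv_sq_le (W := W) p
  have h2 := multiplier_sq_mul_radiusSq hL p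
  have hG := gradSq_nonneg (W := W) p
  calc (multiplier L p * radialDeriv W p) ^ 2
      = multiplier L p ^ 2 * radialDeriv W p ^ 2 := by ring
    _ ≤ multiplier L p ^ 2 * (radiusSq p * gradSq W p) :=
        mul_le_mul_of_nonneg_left h1 (sq_nonneg _)
    _ = L ^ 2 * (1 - multiplier L p ^ 2) * gradSq W p := by rw [← h2]; ring
    _ ≤ L ^ 2 * gradSq W p := by
        have : 0 ≤ L ^ 2 * multiplier L p ^ 2 * gradSq W p := by positivity
        nlinarith

/-- The pointwise coercivity behind the Morawetz estimate. -/
theorem morawetz_integrand_le (hL : 0 < L) (hε₀ : 0 < ε₀) (ha_nonneg : ∀ x, 0 ≤ a x)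
    (ha_bdd : ∀ x, a x ≤ M) (ha_far : ∀ x, L < ‖x‖ → ε₀ ≤ a x) (p : SpaceTime) :
    -(a p.2 * pd timeDir W p * (multiplier L p * radialDeriv W p))
        - multiplier L p * gradSq W p
        + multiplier L p ^ 3 / L ^ 2 * radialDeriv W p ^ 2
        + (multiplier L p - multiplier L p ^ 3 * radiusSq p / (2 * L ^ 2))
          * (gradSq W p - pd timeDir W p ^ 2)
        + 1 / 3 * (pd timeDir W p ^ 2 - gradSq W p)
      ≤ -(1 / 24) * density W p
        + (5 / (12 * ε₀) + 6 * L ^ 2 * M) * (a p.2 * pd timeDir W p ^ 2) := by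
  have hm0 := multiplier_pos L p
  have hm1 := multiplier_le_one L p
  have hms := multiplier_sq_mul_radiusSq hL p
  have hD := radial_deriv_sq_le (W := W) p
  have hmD := multiplier_radialDeriv_sq_le (W := W) hL p
  have hG := gradSq_nonneg (W := W) p
  have ha0 := ha_nonneg p.2
  have haM := ha_bdd p.2
  have hL2 : 0 < L ^ 2 := by positivity
  have hrad : multiplier L p ^ 3 / L ^ 2 * radialDeriv W p ^ 2
      ≤ (multiplier L p - multiplier L p ^ 3) * gradSq W p := by
    have e : multiplier L p ^ 3 / L ^ 2 * (radiusSq p * gradSq W p)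
        = (multiplier L p - multiplier L p ^ 3) * gradSq W p := by
      have : multiplier L p ^ 3 / L ^ 2 * (radiusSq p * gradSq W p)
          = multiplier L p / L ^ 2 * (multiplier L p ^ 2 * radiusSq p) * gradSq W p := by ring
      rw [this, hms]
      field_simp
    rw [← e]
    exact mul_le_mul_of_nonneg_left hD (by positivity)
  have hdiv : multiplier L p - multiplier L p ^ 3 * radiusSq p / (2 * L ^ 2)
      = (multiplier L p + multiplier L p ^ 3) / 2 := by
    have : multiplier L p ^ 3 * radiusSq p / (2 * L ^ 2)
        = multiplier L p / (2 * L ^ 2) * (multiplier L p ^ 2 * radiusSq p) := by ring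
    rw [this, hms]
    field_simp
    ring
  rw [hdiv]
  -- Inside the ball m² ≥ 1/2 gives (m + m³)/2 ≥ 5/12, which exceeds 1/3 by 1/12. Outside, the
  -- missing 5/12 is paid by the damping a ≥ ε₀.
  have htime : 1 / 3 * pd timeDir W p ^ 2
      - (multiplier L p + multiplier L p ^ 3) / 2 * pd timeDir W p ^ 2
      ≤ -(1 / 12) * pd timeDir W p ^ 2 + 5 / (12 * ε₀) * (a p.2 * pd timeDir W p ^ 2) := by
    have hsq := sq_nonneg (pd timeDir W p)
    rcases le_or_gt ‖p.2‖ L with h | h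
    · have hs : radiusSq p ≤ L ^ 2 := by
        rw [radiusSq_eq]; exact pow_le_pow_left₀ (norm_nonneg _) h 2
      have hm2 : 1 / 2 ≤ multiplier L p ^ 2 := by
        have := mul_le_mul_of_nonneg_left hs (sq_nonneg (multiplier L p))
        rw [hms] at this
        have : L ^ 2 * (1 - 2 * multiplier L p ^ 2) ≤ L ^ 2 * 0 := by linarith
        linarith [le_of_mul_le_mul_left this hL2]
      have hm7 : 7 / 10 ≤ multiplier L p := by nlinarith
      have hc : 5 / 12 ≤ (multiplier L p + multiplier L p ^ 3) / 2 := by nlinarith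
      have h1 := mul_le_mul_of_nonneg_right hc hsq
      have h2 : 0 ≤ 5 / (12 * ε₀) * (a p.2 * pd timeDir W p ^ 2) := by positivity
      linarith
    · have hae := ha_far p.2 h
      have h1 : 5 / 12 * pd timeDir W p ^ 2 ≤ 5 / (12 * ε₀) * (a p.2 * pd timeDir W p ^ 2) := by
        have := mul_le_mul_of_nonneg_right hae hsq
        calc 5 / 12 * pd timeDir W p ^ 2 = 5 / (12 * ε₀) * (ε₀ * pd timeDir W p ^ 2) := by
              field_simp
          _ ≤ _ := mul_le_mul_of_nonneg_left this (by positivity)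
      have h2 : 0 ≤ (multiplier L p + multiplier L p ^ 3) / 2 * pd timeDir W p ^ 2 := by
        positivity
      linarith
  -- After `hrad` the gradient coefficients sum to (m - m³)/2 - 1/3, at most -1/12. Half of that
  -- margin is spent on the cross term, leaving -1/24. The weight 1/3 works because it lies between
  -- 1/4 and 5/12.
  have hgrad : (multiplier L p - multiplier L p ^ 3) / 2 * gradSq W p ≤ 1 / 4 * gradSq W p := by
    refine mul_le_mul_of_nonneg_right ?_ hG
    nlinarith [sq_nonneg (multiplier L p - 1 / 2),
      mul_nonneg hm0.le (sq_nonneg (multiplier L p - 1 / 2))]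
  have hcross : -(a p.2 * pd timeDir W p * (multiplier L p * radialDeriv W p))
      ≤ 1 / 24 * gradSq W p + 6 * L ^ 2 * M * (a p.2 * pd timeDir W p ^ 2) := by
    have h1 : 0 ≤ (1 / 24) * ((multiplier L p * radialDeriv W p) / L
        + 12 * L * (a p.2 * pd timeDir W p)) ^ 2 := by positivity
    have h2 : (1 / 24) * ((multiplier L p * radialDeriv W p) / L
        + 12 * L * (a p.2 * pd timeDir W p)) ^ 2
        = (1 / 24) * ((multiplier L p * radialDeriv W p) ^ 2 / L ^ 2)
          + a p.2 * pd timeDir W p * (multiplier L p * radialDeriv W p)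
          + 6 * L ^ 2 * (a p.2 * (a p.2 * pd timeDir W p ^ 2)) := by
      field_simp
      ring
    have h3 : (multiplier L p * radialDeriv W p) ^ 2 / L ^ 2 ≤ gradSq W p := by
      rw [div_le_iff₀ hL2]; linarith
    have h4 : a p.2 * (a p.2 * pd timeDir W p ^ 2) ≤ M * (a p.2 * pd timeDir W p ^ 2) :=
      mul_le_mul_of_nonneg_right haM (by positivity)
    have h5 := mul_le_mul_of_nonneg_left h4 (by positivity : 0 ≤ 6 * L ^ 2)
    nlinarith
  have hdens : density W p = pd timeDir W p ^ 2 + gradSq W p := rfl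
  rw [hdens]
  have hsq := sq_nonneg (pd timeDir W p)
  linarith

end MorawetzBounds

/-! ### Primitives in time. -/

section TimeIntegral

/-- The primitive in time of `F`, vanishing at time `1`. -/
def timeIntegral (F : SpaceTime → ℝ) (p : SpaceTime) : ℝ :=
  ∫ s in (1 : ℝ)..p.1, F (s, p.2)

variable {F : SpaceTime → ℝ}

/-- Rescaling to [0, 1] moves the variable endpoint into the integrand, so joint C¹ regularity in
time and space follows from differentiation under the integral over a fixed compact set. -/
theorem timeIntegral_eq_setIntegral (F : SpaceTime → ℝ) (p : SpaceTime) :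
    timeIntegral F p
      = ∫ σ in Icc (0 : ℝ) 1, (p.1 - 1) * F (1 + σ * (p.1 - 1), p.2) := by
  rw [integral_Icc_eq_integral_Ioc, ← intervalIntegral.integral_of_le zero_le_one,
    intervalIntegral.integral_const_mul, timeIntegral]
  have := intervalIntegral.mul_integral_comp_add_mul (a := 0) (b := 1)
    (f := fun s => F (s, p.2)) (p.1 - 1) 1
  simp only [mul_zero, add_zero, mul_one, add_sub_cancel] at this
  rw [← this]
  simp only [mul_comm]

theorem contDiff_timeIntegral (hF : ContDiff ℝ 1 F) : ContDiff ℝ 1 (timeIntegral F) := by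
  have h : ContDiff ℝ 1 fun r : SpaceTime × ℝ =>
      (r.1.1 - 1) * F (1 + r.2 * (r.1.1 - 1), r.1.2) := by fun_prop
  have := contDiff_setIntegral_of_contDiff volume h (isCompact_Icc (a := (0 : ℝ)) (b := 1))
  rwa [show (fun p : SpaceTime => ∫ σ in Icc (0 : ℝ) 1, (p.1 - 1) * F (1 + σ * (p.1 - 1), p.2))
    = timeIntegral F from funext fun p => (timeIntegral_eq_setIntegral F p).symm] at this

theorem pd_timeDir_timeIntegral (hF : ContDiff ℝ 1 F) (p : SpaceTime) :
    pd timeDir (timeIntegral F) p = F p := by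
  obtain ⟨t, x⟩ := p
  have h1 := hasDerivAt_time ((contDiff_timeIntegral hF).differentiable (by norm_num)) t x
  have hc : Continuous fun s => F (s, x) := hF.continuous.comp (by fun_prop)
  have h2 : HasDerivAt (fun s => timeIntegral F (s, x)) (F (t, x)) t :=
    intervalIntegral.integral_hasDerivAt_right (hc.intervalIntegrable _ _)
      (hc.stronglyMeasurableAtFilter _ _) hc.continuousAt
  exact h1.unique h2

theorem pd_spaceDir_timeIntegral (hF : ContDiff ℝ 1 F) (i : Fin 2) (p : SpaceTime) :
    pd (spaceDir i) (timeIntegral F) p = timeIntegral (pd (spaceDir i) F) p := by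
  have h : ContDiff ℝ 1 fun r : SpaceTime × ℝ =>
      (r.1.1 - 1) * F (1 + r.2 * (r.1.1 - 1), r.1.2) := by fun_prop
  have key := hasFDerivAt_setIntegral_of_contDiff volume h
    (isCompact_Icc (a := (0 : ℝ)) (b := 1)) p
  rw [show (fun p : SpaceTime => ∫ σ in Icc (0 : ℝ) 1, (p.1 - 1) * F (1 + σ * (p.1 - 1), p.2))
    = timeIntegral F from funext fun p => (timeIntegral_eq_setIntegral F p).symm] at key
  rw [pd, key.fderiv, timeIntegral_eq_setIntegral, ContinuousLinearMap.integral_apply]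
  · refine setIntegral_congr_fun measurableSet_Icc fun σ _ => ?_
    have hF' : HasFDerivAt F (fderiv ℝ F (1 + σ * (p.1 - 1), p.2)) (1 + σ * (p.1 - 1), p.2) :=
      (hF.differentiable (by norm_num) _).hasFDerivAt
    have hl := (h.differentiable (by norm_num) (p, σ)).hasFDerivAt.comp_hasDerivAt_of_eq (0 : ℝ)
      (f := fun τ : ℝ => (p + τ • spaceDir i, σ)) (f' := (spaceDir i, 0)) (by
        refine HasDerivAt.prodMk ?_ (hasDerivAt_const _ _)
        simpa using ((hasDerivAt_id (0 : ℝ)).smul_const (spaceDir i)).const_add p) (by simp)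
    have hr : HasDerivAt (fun τ : ℝ => (p.1 - 1) * F ((1 + σ * (p.1 - 1), p.2) + τ • spaceDir i))
        ((p.1 - 1) * pd (spaceDir i) F (1 + σ * (p.1 - 1), p.2)) 0 := by
      refine HasDerivAt.const_mul _ ?_
      exact hF'.comp_hasDerivAt_of_eq (0 : ℝ) (by
        simpa using ((hasDerivAt_id (0 : ℝ)).smul_const (spaceDir i)).const_add
          ((1 + σ * (p.1 - 1), p.2) : SpaceTime)) (by simp)
    have heq : (fun r : SpaceTime × ℝ => (r.1.1 - 1) * F (1 + r.2 * (r.1.1 - 1), r.1.2)) ∘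
        (fun τ : ℝ => (p + τ • spaceDir i, σ))
        = fun τ : ℝ => (p.1 - 1) * F ((1 + σ * (p.1 - 1), p.2) + τ • spaceDir i) := by
      funext τ
      simp [spaceDir]
    rw [heq] at hl
    exact hl.unique hr
  · exact (((h.continuous_fderiv (by norm_num)).comp
      (by fun_prop : Continuous fun σ : ℝ => (p, σ))).clm_comp
        continuous_const).continuousOn.integrableOn_compact isCompact_Icc

/-- Between the times 1 and t all |s| are at most 1 + |t|, hence the radius ρ + 1. -/
theorem SpatiallyBounded.timeIntegral (hF : SpatiallyBounded F) :
    SpatiallyBounded (timeIntegral F) := by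
  obtain ⟨ρ, h0, h⟩ := hF
  refine ⟨ρ + 1, by linarith, fun p hp => ?_⟩
  have : ∀ s ∈ uIcc 1 p.1, F (s, p.2) = 0 := by
    intro s hs
    refine h _ ?_
    have h1 : |s| ≤ max 1 |p.1| := by
      have := abs_le_max_abs_abs hs.1 hs.2
      rcases le_total 1 p.1 with h1 | h1
      · simpa [h1] using this
      · simpa [h1, max_comm] using this
    have h2 : max 1 |p.1| ≤ 1 + |p.1| :=
      max_le (by linarith [abs_nonneg p.1]) (by linarith)
    simp only
    linarith
  rw [DampedWave.timeIntegral, intervalIntegral.integral_congr this]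
  simp

end TimeIntegral

/-! ### The energy identity and the energy of the time primitive. -/

section Decay

variable {a : Plane → ℝ} {W : SpaceTime → ℝ} {L M ε₀ : ℝ}

theorem hasDerivAt_energy (hW : ContDiff ℝ 2 W) (hs : SpatiallyBounded W) {t : ℝ}
    (heq : ∀ x, dalembert W (t, x) + a x * pd timeDir W (t, x) = 0) :
    HasDerivAt (fun s => ∫ x, density W (s, x))
      (-2 * ∫ x, a x * pd timeDir W (t, x) ^ 2) t := by
  have := hasDerivAt_weighted_energy hW (ψ := fun _ => 1) contDiff_const
    (fun v => (hs.directional v).mul_right _) t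
  simp only [pd_const, mul_one, mul_zero, add_zero, sub_zero] at this
  refine this.congr_deriv ?_
  rw [← integral_const_mul]
  refine integral_congr_ae (Eventually.of_forall fun x => ?_)
  have h := heq x
  simp only
  linear_combination 2 * pd timeDir W (t, x) * h

/-- Integrating the equation in time turns the `L²` norm into a conserved energy. -/
theorem exists_antiderivative_energy (ha : ContDiff ℝ 2 a) (hW : ContDiff ℝ 2 W)
    (hs : SpatiallyBounded W)
    (heq : ∀ t, 1 ≤ t → ∀ x, dalembert W (t, x) + a x * pd timeDir W (t, x) = 0) :
    ∃ (B : ℝ → ℝ) (C ρ : ℝ), 0 ≤ ρ ∧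
      (∀ t, 1 ≤ t → HasDerivAt B (-∫ x, a x * W (t, x) ^ 2) t) ∧
      ∀ t, -(C * (1 + Real.log (1 + (ρ + |t|) ^ 2))) ≤ B t := by
  have cW : ContDiff ℝ 1 W := hW.of_le (by norm_num)
  have ha' : ContDiff ℝ 1 a := ha.of_le (by norm_num)
  have c : ∀ v, ContDiff ℝ 1 (pd v W) := fun v => contDiff_one_pd hW
  have ct := c timeDir
  -- V₀ and V₁ are the spatial derivatives of V, written as primitives of ∂ᵢW so that their own C¹
  -- regularity is immediate.
  obtain ⟨V, hV⟩ : ∃ V, V = timeIntegral W := ⟨_, rfl⟩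
  obtain ⟨V₀, hV₀⟩ : ∃ V₀, V₀ = timeIntegral (pd (spaceDir 0) W) := ⟨_, rfl⟩
  obtain ⟨V₁, hV₁⟩ : ∃ V₁, V₁ = timeIntegral (pd (spaceDir 1) W) := ⟨_, rfl⟩
  have cV : ContDiff ℝ 1 V := hV ▸ contDiff_timeIntegral cW
  have cV₀ : ContDiff ℝ 1 V₀ := hV₀ ▸ contDiff_timeIntegral (c _)
  have cV₁ : ContDiff ℝ 1 V₁ := hV₁ ▸ contDiff_timeIntegral (c _)
  have bV : SpatiallyBounded V := hV ▸ hs.timeIntegral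
  have bV₀ : SpatiallyBounded V₀ := hV₀ ▸ (hs.directional _).timeIntegral
  have bV₁ : SpatiallyBounded V₁ := hV₁ ▸ (hs.directional _).timeIntegral
  have gV : ∀ p, gradSq V p = V₀ p ^ 2 + V₁ p ^ 2 := fun p => by
    rw [gradSq, hV, hV₀, hV₁, pd_spaceDir_timeIntegral cW, pd_spaceDir_timeIntegral cW]
  -- The integration constant at time 1 becomes the source: V_tt - ΔV + a V_t = f.
  obtain ⟨f, hf⟩ : ∃ f : Plane → ℝ, f = fun x => pd timeDir W (1, x) + a x * W (1, x) := ⟨_, rfl⟩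
  have cf : ContDiff ℝ 1 f := by
    rw [hf]; fun_prop
  have sf : HasCompactSupport f := by
    rw [hf]
    exact (((hs.directional timeDir).add (hs.mul_left fun p => a p.2)).hasCompactSupport 1)
  have dW : Differentiable ℝ W := cW.differentiable (by norm_num)
  have dV : Differentiable ℝ V := cV.differentiable (by norm_num)
  have dV₀ : Differentiable ℝ V₀ := cV₀.differentiable (by norm_num)
  have dV₁ : Differentiable ℝ V₁ := cV₁.differentiable (by norm_num)
  have df : Differentiable ℝ f := cf.differentiable (by norm_num)
  have hflux : ∀ t, 1 ≤ t → ∀ x, pd timeDir W (t, x) - pd (spaceDir 0) V₀ (t, x)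
      - pd (spaceDir 1) V₁ (t, x) - f x = -(a x * W (t, x)) := by
    intro t ht x
    have hc : ∀ i, Continuous fun s => pd (spaceDir i) (pd (spaceDir i) W) (s, x) :=
      fun i => (continuous_pd (c _)).comp (by fun_prop)
    have htt : Continuous fun s => pd timeDir (pd timeDir W) (s, x) :=
      (continuous_pd ct).comp (by fun_prop)
    have hta : Continuous fun s => a x * pd timeDir W (s, x) :=
      continuous_const.mul (ct.continuous.comp (by fun_prop))
    rw [hV₀, hV₁, pd_spaceDir_timeIntegral (c _), pd_spaceDir_timeIntegral (c _)]
    simp only [timeIntegral]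
    have e1 := intervalIntegral.integral_add (μ := volume) ((hc 0).intervalIntegrable 1 t)
      ((hc 1).intervalIntegrable 1 t)
    have e2 : (∫ s in (1 : ℝ)..t, (pd (spaceDir 0) (pd (spaceDir 0) W) (s, x)
        + pd (spaceDir 1) (pd (spaceDir 1) W) (s, x)))
        = ∫ s in (1 : ℝ)..t, (pd timeDir (pd timeDir W) (s, x) + a x * pd timeDir W (s, x)) := by
      refine intervalIntegral.integral_congr fun s hs => ?_
      rw [uIcc_of_le ht] at hs
      have := heq s hs.1 x
      simp only [dalembert] at this
      linarith
    have e3 : (∫ s in (1 : ℝ)..t, (pd timeDir (pd timeDir W) (s, x) + a x * pd timeDir W (s, x)))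
        = (pd timeDir W (t, x) + a x * W (t, x)) - (pd timeDir W (1, x) + a x * W (1, x)) := by
      refine intervalIntegral.integral_eq_sub_of_hasDerivAt
        (f := fun s => pd timeDir W (s, x) + a x * W (s, x)) (fun s _ => ?_)
        ((htt.add hta).intervalIntegrable _ _)
      exact (hasDerivAt_time (ct.differentiable (by norm_num)) s x).add
        ((hasDerivAt_time dW s x).const_mul (a x))
    rw [hf]
    simp only
    linarith
  have hder := hasDerivAt_integral_of_flux
    (F := fun p => 1 / 2 * (W p ^ 2 + (V₀ p ^ 2 + V₁ p ^ 2)) - f p.2 * V p)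
    (J₀ := fun p => W p * V₀ p) (J₁ := fun p => W p * V₁ p)
    (((hs.sq.add (bV₀.sq.add bV₁.sq)).mul_left fun _ => 1 / 2).sub (bV.mul_left _))
    (hs.mul_right _) (hs.mul_right _) (by fun_prop) (by fun_prop) (by fun_prop)
  obtain ⟨ρ, hρ, hρV⟩ := bV
  have bV : SpatiallyBounded V := ⟨ρ, hρ, hρV⟩
  -- B is the energy of V, with W = V_t, minus ∫ f V. The constant comes from splitting f V as f (1
  -- + |x|²) times V/(1 + |x|²), with Young weights A and A⁻¹.
  refine ⟨_, 1 / 2 * ∫ x, f x ^ 2 * (1 + radiusSq (0, x)) ^ 2, ρ, hρ,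
    fun t ht => (hder t).congr_deriv ?_, fun t => ?_⟩
  · rw [← integral_neg]
    refine integral_congr_ae (Eventually.of_forall fun x => ?_)
    have hpf : pd timeDir (fun q => f q.2) (t, x) = 0 := pd_timeDir_comp_snd df _
    have hh := hflux t ht x
    simp (disch := fun_prop) only [pd_add, pd_sub, pd_mul, pd_sq, pd_const, hpf]
    have e : pd timeDir V (t, x) = W (t, x) := hV ▸ pd_timeDir_timeIntegral cW _
    have e0 : pd timeDir V₀ (t, x) = pd (spaceDir 0) W (t, x) :=
      hV₀ ▸ pd_timeDir_timeIntegral (c _) _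
    have e1 : pd timeDir V₁ (t, x) = pd (spaceDir 1) W (t, x) :=
      hV₁ ▸ pd_timeDir_timeIntegral (c _) _
    rw [e, e0, e1]
    linear_combination W (t, x) * hh
  · set A : ℝ := 1 + Real.log (1 + (ρ + |t|) ^ 2) with hA
    have hA1 : 0 < A := by
      have : 0 ≤ Real.log (1 + (ρ + |t|) ^ 2) :=
        Real.log_nonneg (by nlinarith [sq_nonneg (ρ + |t|)])
      linarith
    have hardy := integral_weighted_sq_le cV hρ hρV t
    rw [← hA] at hardy
    have k1 := contDiff_inv_one_add_radiusSq.continuous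
    have k2 : Continuous radiusSq := (contDiff_radiusSq (n := 1)).continuous
    have kV := cV.continuous
    have kf := cf.continuous
    have iG : Integrable fun x => gradSq V (t, x) := bV.gradSq.integrable (continuous_gradSq cV) t
    have iV : Integrable fun x => (1 + radiusSq (t, x))⁻¹ ^ 2 * V (t, x) ^ 2 :=
      (bV.sq.mul_left fun p => (1 + radiusSq p)⁻¹ ^ 2).integrable (by fun_prop) t
    have iF : Integrable fun x => f x ^ 2 * (1 + radiusSq (0, x)) ^ 2 := by
      refine Continuous.integrable_of_hasCompactSupport (by fun_prop) ?_
      refine sf.mono fun x hx => ?_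
      simp only [Function.mem_support] at hx ⊢
      intro h
      simp [h] at hx
    have iT : Integrable fun x => 1 / 2 * (W (t, x) ^ 2 + (V₀ (t, x) ^ 2 + V₁ (t, x) ^ 2))
        - f x * V (t, x) :=
      (((hs.sq.add (bV₀.sq.add bV₁.sq)).mul_left fun _ => 1 / 2).sub
        (bV.mul_left fun p => f p.2)).integrable (by fun_prop) t
    have key := integral_mono (((iG.const_mul (1 / 2)).sub (iF.const_mul (A / 2))).sub
      (iV.const_mul (1 / 2 * A⁻¹))) iT fun x => by
        have hr : radiusSq (0, x) = radiusSq (t, x) := rfl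
        have hq : (1 + radiusSq (t, x)) * (1 + radiusSq (t, x))⁻¹ = 1 :=
          mul_inv_cancel₀ (by linarith [radiusSq_nonneg (t, x)])
        simp only [Pi.sub_apply, gV, hr]
        generalize (1 + radiusSq (t, x))⁻¹ = q at *
        generalize 1 + radiusSq (t, x) = r at *
        have h1 : 0 ≤ 1 / 2 * A⁻¹ * (q * V (t, x) - A * (f x * r)) ^ 2 := by positivity
        have h2 : 1 / 2 * A⁻¹ * (q * V (t, x) - A * (f x * r)) ^ 2
            = 1 / 2 * A⁻¹ * (q ^ 2 * V (t, x) ^ 2) - (r * q) * (f x * V (t, x))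
              + A / 2 * (f x ^ 2 * r ^ 2) := by
          field_simp
          ring
        rw [hq] at h2
        nlinarith [sq_nonneg (W (t, x))]
    have s1 := integral_sub ((iG.const_mul (1 / 2)).sub (iF.const_mul (A / 2)))
      (iV.const_mul (1 / 2 * A⁻¹))
    have s2 := integral_sub (iG.const_mul (1 / 2)) (iF.const_mul (A / 2))
    simp only [Pi.sub_apply] at s1 s2 key
    rw [s1, s2, integral_const_mul, integral_const_mul, integral_const_mul] at key
    -- The Hardy loss A is cancelled by the Young weight A⁻¹, so the Dirichlet energy of V absorbs
    -- the term completely and A survives only in front of the fixed integral of f.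
    have h3 : 1 / 2 * A⁻¹ * ∫ x, (1 + radiusSq (t, x))⁻¹ ^ 2 * V (t, x) ^ 2
        ≤ 1 / 2 * ∫ x, gradSq V (t, x) := by
      rw [mul_assoc]
      refine mul_le_mul_of_nonneg_left ?_ (by norm_num)
      rw [inv_mul_le_iff₀ hA1]
      exact hardy
    refine le_trans ?_ key
    linarith

end Decay

/-! ### Assembling the Lyapunov functional. -/

section Decay

variable {a : Plane → ℝ} {W : SpaceTime → ℝ} {L M ε₀ : ℝ}

theorem abs_multiplier_term_le (hL : 0 < L) (p : SpaceTime) :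
    |multiplier L p * radialDeriv W p * pd timeDir W p| ≤ L / 2 * density W p := by
  have h1 := multiplier_radialDeriv_sq_le (W := W) hL p
  have h2 : (multiplier L p * radialDeriv W p) ^ 2 / L ≤ L * gradSq W p := by
    rw [div_le_iff₀ hL]; linarith
  have e1 : (multiplier L p * radialDeriv W p + L * pd timeDir W p) ^ 2 / L
      = (multiplier L p * radialDeriv W p) ^ 2 / L
        + 2 * (multiplier L p * radialDeriv W p * pd timeDir W p)
        + L * pd timeDir W p ^ 2 := by field_simp; ring
  have e2 : (multiplier L p * radialDeriv W p - L * pd timeDir W p) ^ 2 / L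
      = (multiplier L p * radialDeriv W p) ^ 2 / L
        - 2 * (multiplier L p * radialDeriv W p * pd timeDir W p)
        + L * pd timeDir W p ^ 2 := by field_simp; ring
  have p1 : 0 ≤ (multiplier L p * radialDeriv W p + L * pd timeDir W p) ^ 2 / L := by positivity
  have p2 : 0 ≤ (multiplier L p * radialDeriv W p - L * pd timeDir W p) ^ 2 / L := by positivity
  rw [abs_le, density]
  constructor <;> linarith

/-- Decay for a solution of class `C²` on all of space-time, of the equation at times `t ≥ 1`. -/
theorem exists_decay (ha : ContDiff ℝ 2 a) (ha_nonneg : ∀ x, 0 ≤ a x) (ha_bdd : ∀ x, a x ≤ M)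
    (hL : 0 < L) (hε₀ : 0 < ε₀) (ha_far : ∀ x, L < ‖x‖ → ε₀ ≤ a x)
    (hW : ContDiff ℝ 2 W) (hs : SpatiallyBounded W)
    (heq : ∀ t, 1 ≤ t → ∀ x, dalembert W (t, x) + a x * pd timeDir W (t, x) = 0) :
    ∃ K, ∀ t, 2 ≤ t → ∫ x, W (t, x) ^ 2 ≤ K * (t⁻¹ * Real.log t) ∧
      ∫ x, density W (t, x) ≤ K * ((t ^ 2)⁻¹ * Real.log t) := by
  have cW : ContDiff ℝ 1 W := hW.of_le (by norm_num)
  have kW := cW.continuous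
  have ka := ha.continuous
  have kt := continuous_pd (v := timeDir) cW
  have hM : 0 ≤ M := (ha_nonneg 0).trans (ha_bdd 0)
  have iN : ∀ t, Integrable fun x => W (t, x) ^ 2 := hs.sq.integrable (by fun_prop)
  have iE : ∀ t, Integrable fun x => density W (t, x) :=
    hs.density.integrable (contDiff_density hW).continuous
  have iGr : ∀ t, Integrable fun x => gradSq W (t, x) :=
    hs.gradSq.integrable (contDiff_gradSq hW).continuous
  have iA : ∀ t, Integrable fun x => a x * W (t, x) ^ 2 :=
    (hs.sq.mul_left fun p => a p.2).integrable (by fun_prop)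
  have iD : ∀ t, Integrable fun x => a x * pd timeDir W (t, x) ^ 2 :=
    ((hs.directional timeDir).sq.mul_left fun p => a p.2).integrable (by fun_prop)
  have iG : ∀ t, Integrable fun x => morawetzDensity L a W (t, x) :=
    (hs.morawetzDensity L a).integrable (contDiff_morawetzDensity ha hW).continuous
  obtain ⟨Cp, hCp, hpoin⟩ := exists_integral_sq_le ha.continuous ha_nonneg hL hε₀ ha_far
  obtain ⟨B, C, ρ, hρ, hB, hBl⟩ := exists_antiderivative_energy ha hW hs heq
  set C₂ : ℝ := 5 / (12 * ε₀) + 6 * L ^ 2 * M with hC₂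
  have hC₂0 : 0 ≤ C₂ := by positivity
  -- The first three summands cancel the negative multiple of E in the lower bound `hlow`, the 1
  -- leaves a full E, and C₂ lets -2 K D dominate the error C₂ D of the Morawetz estimate.
  set K : ℝ := L / 2 + Cp / 3 + 1 / 6 + 1 + C₂ with hK
  have hGle : ∀ t, ∫ x, gradSq W (t, x) ≤ ∫ x, density W (t, x) := fun t =>
    integral_mono (iGr t) (iE t) fun x => le_add_of_nonneg_left (sq_nonneg _)
  have hN : ∀ t, ∫ x, W (t, x) ^ 2
      ≤ Cp * ((∫ x, density W (t, x)) + ∫ x, a x * W (t, x) ^ 2) := fun t =>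
    (hpoin W cW hs t).trans (mul_le_mul_of_nonneg_left (by linarith [hGle t]) hCp.le)
  have integrand_integrable : ∀ t, Integrable fun x =>
        -(a x * pd timeDir W (t, x) * (multiplier L (t, x) * radialDeriv W (t, x)))
        - multiplier L (t, x) * gradSq W (t, x)
        + multiplier L (t, x) ^ 3 / L ^ 2 * radialDeriv W (t, x) ^ 2
        + (multiplier L (t, x) - multiplier L (t, x) ^ 3 * radiusSq (t, x) / (2 * L ^ 2))
          * (gradSq W (t, x) - pd timeDir W (t, x) ^ 2)
        + 1 / 3 * (pd timeDir W (t, x) ^ 2 - gradSq W (t, x)) := by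
    intro t
    have bt := hs.directional timeDir
    have bg := hs.gradSq
    have bD : SpatiallyBounded (radialDeriv W) :=
      ((hs.directional (spaceDir 0)).mul_left fun p => p.2 0).add
        ((hs.directional (spaceDir 1)).mul_left fun p => p.2 1)
    have km := (contDiff_multiplier L).continuous
    have kg := (contDiff_gradSq hW).continuous
    have kD := (contDiff_radialDeriv hW).continuous
    have kr : Continuous radiusSq := (contDiff_radiusSq (n := 1)).continuous
    refine (((((((bD.mul_left (multiplier L)).mul_left
      fun p => a p.2 * pd timeDir W p).mul_left fun _ => -1).sub
      (bg.mul_left (multiplier L))).add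
      (bD.sq.mul_left fun p => multiplier L p ^ 3 / L ^ 2)).add
      ((bg.sub bt.sq).mul_left
        fun p => multiplier L p - multiplier L p ^ 3 * radiusSq p / (2 * L ^ 2))).add
      ((bt.sq.sub bg).mul_left fun _ => 1 / 3)).integrable (by fun_prop) t |>.congr
        (Eventually.of_forall fun x => ?_)
    simp only
    ring
  have hder : ∀ t, 1 ≤ t → ∃ g, HasDerivAt (fun s => ∫ x, morawetzDensity L a W (s, x)) g t ∧
      g ≤ -(1 / 24) * (∫ x, density W (t, x)) + C₂ * ∫ x, a x * pd timeDir W (t, x) ^ 2 := by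
    intro t ht
    refine ⟨_, hasDerivAt_morawetz ha hW hs t, ?_⟩
    rw [← integral_const_mul, ← integral_const_mul, ← integral_add ((iE t).const_mul _)
      ((iD t).const_mul _)]
    have e : ∀ x, (multiplier L (t, x) * radialDeriv W (t, x) + 1 / 3 * W (t, x))
          * (dalembert W (t, x) + a x * pd timeDir W (t, x))
        - a x * pd timeDir W (t, x) * (multiplier L (t, x) * radialDeriv W (t, x))
        - multiplier L (t, x) * gradSq W (t, x)
        + multiplier L (t, x) ^ 3 / L ^ 2 * radialDeriv W (t, x) ^ 2
        + (multiplier L (t, x) - multiplier L (t, x) ^ 3 * radiusSq (t, x) / (2 * L ^ 2))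
          * (gradSq W (t, x) - pd timeDir W (t, x) ^ 2)
        + 1 / 3 * (pd timeDir W (t, x) ^ 2 - gradSq W (t, x))
        = -(a x * pd timeDir W (t, x) * (multiplier L (t, x) * radialDeriv W (t, x)))
        - multiplier L (t, x) * gradSq W (t, x)
        + multiplier L (t, x) ^ 3 / L ^ 2 * radialDeriv W (t, x) ^ 2
        + (multiplier L (t, x) - multiplier L (t, x) ^ 3 * radiusSq (t, x) / (2 * L ^ 2))
          * (gradSq W (t, x) - pd timeDir W (t, x) ^ 2)
        + 1 / 3 * (pd timeDir W (t, x) ^ 2 - gradSq W (t, x)) := by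
      intro x
      rw [heq t ht x]
      ring
    simp only [e]
    refine integral_mono (integrand_integrable t) (((iE t).const_mul _).add ((iD t).const_mul _))
      fun x => ?_
    exact morawetz_integrand_le hL hε₀ ha_nonneg ha_bdd ha_far (t, x)
  -- By Poincaré, A/6 supplies N/(6 Cp) up to E/6. Young's inequality on W W_t / 3 spends half of
  -- it, leaving N/(12 Cp).
  have hlow : ∀ t, -(L / 2 + Cp / 3 + 1 / 6) * (∫ x, density W (t, x))
      + 1 / (12 * Cp) * (∫ x, W (t, x) ^ 2) ≤ ∫ x, morawetzDensity L a W (t, x) := by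
    intro t
    have key := integral_mono ((((iE t).const_mul (-(L / 2 + Cp / 3))).sub
      ((iN t).const_mul (1 / (12 * Cp)))).add ((iA t).const_mul (1 / 6))) (iG t) fun x => by
        have h1 := (abs_le.1 (abs_multiplier_term_le (W := W) hL (t, x))).1
        have h2 : 0 ≤ 1 / (12 * Cp) * (W (t, x) + 2 * Cp * pd timeDir W (t, x)) ^ 2 := by
          positivity
        have h3 : 1 / (12 * Cp) * (W (t, x) + 2 * Cp * pd timeDir W (t, x)) ^ 2
            = 1 / (12 * Cp) * W (t, x) ^ 2 + 1 / 3 * (W (t, x) * pd timeDir W (t, x))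
              + Cp / 3 * pd timeDir W (t, x) ^ 2 := by
          field_simp
          ring
        have h4 : Cp / 3 * pd timeDir W (t, x) ^ 2 ≤ Cp / 3 * density W (t, x) :=
          mul_le_mul_of_nonneg_left (le_add_of_nonneg_right (gradSq_nonneg _)) (by positivity)
        simp only [Pi.add_apply, Pi.sub_apply, morawetzDensity]
        linarith
    have s1 := integral_add (((iE t).const_mul (-(L / 2 + Cp / 3))).sub
      ((iN t).const_mul (1 / (12 * Cp)))) ((iA t).const_mul (1 / 6))
    have s2 := integral_sub ((iE t).const_mul (-(L / 2 + Cp / 3)))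
      ((iN t).const_mul (1 / (12 * Cp)))
    simp only [Pi.sub_apply, Pi.add_apply] at s1 s2 key
    rw [s1, s2, integral_const_mul, integral_const_mul, integral_const_mul] at key
    refine le_trans ?_ key
    have h5 : 1 / (6 * Cp) * ∫ x, W (t, x) ^ 2
        ≤ 1 / 6 * ((∫ x, density W (t, x)) + ∫ x, a x * W (t, x) ^ 2) := by
      calc 1 / (6 * Cp) * ∫ x, W (t, x) ^ 2
          ≤ 1 / (6 * Cp) * (Cp * ((∫ x, density W (t, x)) + ∫ x, a x * W (t, x) ^ 2)) :=
            mul_le_mul_of_nonneg_left (hN t) (by positivity)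
        _ = _ := by field_simp
    have h6 : 1 / (6 * Cp) = 2 * (1 / (12 * Cp)) := by field_simp; norm_num
    rw [h6] at h5
    linarith
  have hup : ∀ t, ∫ x, morawetzDensity L a W (t, x)
      ≤ (L / 2 + 1 / 6) * (∫ x, density W (t, x)) + (1 + M) / 6 * ∫ x, W (t, x) ^ 2 := by
    intro t
    rw [← integral_const_mul, ← integral_const_mul, ← integral_add ((iE t).const_mul _)
      ((iN t).const_mul _)]
    refine integral_mono (iG t) (((iE t).const_mul _).add ((iN t).const_mul _)) fun x => ?_
    have h1 := (abs_le.1 (abs_multiplier_term_le (W := W) hL (t, x))).2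
    have h2 := sq_nonneg (W (t, x) - pd timeDir W (t, x))
    have h3 : pd timeDir W (t, x) ^ 2 ≤ density W (t, x) :=
      le_add_of_nonneg_right (gradSq_nonneg _)
    have h4 : a x * W (t, x) ^ 2 ≤ M * W (t, x) ^ 2 :=
      mul_le_mul_of_nonneg_right (ha_bdd x) (sq_nonneg _)
    simp only [morawetzDensity]
    nlinarith
  choose! g hg hgle using hder
  have hE0 : ∀ t, 0 ≤ ∫ x, density W (t, x) := fun t => integral_nonneg fun x => density_nonneg _
  have hN0 : ∀ t, 0 ≤ ∫ x, W (t, x) ^ 2 := fun t => integral_nonneg fun x => sq_nonneg _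
  have hD0 : ∀ t, 0 ≤ ∫ x, a x * pd timeDir W (t, x) ^ 2 := fun t =>
    integral_nonneg fun x => mul_nonneg (ha_nonneg x) (sq_nonneg _)
  have hE : ∀ t, 1 ≤ t → HasDerivAt (fun s => ∫ x, density W (s, x))
      (-2 * ∫ x, a x * pd timeDir W (t, x) ^ 2) t := fun t ht =>
    hasDerivAt_energy hW hs (heq t ht)
  refine decay_of_lyapunov (c := 1 / 24) (c₁ := min 1 (1 / (12 * Cp)))
    (C₁ := K + (L / 2 + 1 / 6) + (1 + M) / 6) (C₂ := Cp)
    (D := fun t => ∫ x, a x * pd timeDir W (t, x) ^ 2)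
    (A := fun t => ∫ x, a x * W (t, x) ^ 2)
    (X := fun t => (∫ x, morawetzDensity L a W (t, x)) + K * ∫ x, density W (t, x))
    (X' := fun t => g t + K * (-2 * ∫ x, a x * pd timeDir W (t, x) ^ 2)) (B := B)
    (Λ := fun t => |C| * (1 + Real.log (1 + (ρ + |t|) ^ 2)))
    (C₃ := |C| * ((1 + Real.log (1 + (ρ + 1) ^ 2)) / Real.log 2 + 2))
    (by norm_num) (by positivity) (by positivity) hCp hE
    (fun t ht => (hg t ht).add ((hE t ht).const_mul K)) hB hE0 hN0 hD0 ?_ hN ?_ ?_ ?_ ?_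
  · intro t ht
    have h1 := hgle t ht
    have h2 : C₂ * (∫ x, a x * pd timeDir W (t, x) ^ 2)
        ≤ 2 * K * ∫ x, a x * pd timeDir W (t, x) ^ 2 :=
      mul_le_mul_of_nonneg_right (by rw [hK]; linarith) (hD0 t)
    linarith
  · intro t
    have h1 := hlow t
    have h2 := mul_le_mul_of_nonneg_right (min_le_left (1 : ℝ) (1 / (12 * Cp))) (hE0 t)
    have h3 := mul_le_mul_of_nonneg_right (min_le_right (1 : ℝ) (1 / (12 * Cp))) (hN0 t)
    have h4 := mul_nonneg hC₂0 (hE0 t)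
    simp only [hK]
    linarith
  · intro t
    have h1 := hup t
    have h2 : 0 ≤ (K + (L / 2 + 1 / 6)) * ∫ x, W (t, x) ^ 2 := mul_nonneg (by positivity) (hN0 t)
    have h3 : 0 ≤ (1 + M) / 6 * ∫ x, density W (t, x) := mul_nonneg (by positivity) (hE0 t)
    linarith
  · intro t _
    have h0 : 0 ≤ Real.log (1 + (ρ + |t|) ^ 2) :=
      Real.log_nonneg (by nlinarith [sq_nonneg (ρ + |t|)])
    have := mul_le_mul_of_nonneg_right (le_abs_self C)
      (by linarith : 0 ≤ 1 + Real.log (1 + (ρ + |t|) ^ 2))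
    linarith [hBl t]
  · intro t ht
    have := mul_le_mul_of_nonneg_left (one_add_log_radius_le hρ ht) (abs_nonneg C)
    linarith

end Decay

/-! ### Extension to all times and translation to space-time derivatives. -/

section Extension

/-- A smooth positive function of time which is the identity on `[c, ∞)`. -/
def clock (c t : ℝ) : ℝ := c / 2 + (t - c / 2) * Real.smoothTransition (2 * t / c - 1)

theorem clock_eq {c t : ℝ} (hc : 0 < c) (h : c ≤ t) : clock c t = t := by
  have : (1 : ℝ) ≤ 2 * t / c - 1 := by
    rw [le_sub_iff_add_le, le_div_iff₀ hc]; linarith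
  rw [clock, Real.smoothTransition.one_of_one_le this]
  ring

/-- The lower bound keeps the reparametrised time inside the domain of u; the upper one preserves
unit propagation speed for the extension. -/
theorem clock_bounds {c : ℝ} (hc : 0 < c) (t : ℝ) : c / 2 ≤ clock c t ∧ clock c t ≤ c + |t| := by
  rcases le_or_gt t (c / 2) with h | h
  · have : 2 * t / c - 1 ≤ 0 := by
      rw [sub_nonpos, div_le_one hc]; linarith
    rw [clock, Real.smoothTransition.zero_of_nonpos this]
    constructor <;> linarith [abs_nonneg t]
  · have h0 := Real.smoothTransition.nonneg (2 * t / c - 1)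
    have h1 := Real.smoothTransition.le_one (2 * t / c - 1)
    rw [clock]
    constructor <;> nlinarith [le_abs_self t]

theorem contDiff_clock (c : ℝ) : ContDiff ℝ 2 (clock c) := by
  have : ContDiff ℝ 2 Real.smoothTransition := Real.smoothTransition.contDiff (n := 2)
  unfold clock
  fun_prop

/-- An extension to all times of a function on `[0, ∞) × ℝ²`, unchanged for `t ≥ c`. -/
def extension (c : ℝ) (u : ℝ → Plane → ℝ) (p : SpaceTime) : ℝ := u (clock c p.1) p.2

variable {u : ℝ → Plane → ℝ} {c : ℝ}

theorem contDiff_extension (hc : 0 < c)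
    (hu : ContDiffOn ℝ 2 (fun p : ℝ × Plane => u p.1 p.2) (Ici 0 ×ˢ univ)) :
    ContDiff ℝ 2 (extension c u) := by
  have h1 : ContDiff ℝ 2 fun p : SpaceTime => ((clock c p.1, p.2) : SpaceTime) :=
    ((contDiff_clock c).comp contDiff_fst).prodMk contDiff_snd
  rw [← contDiffOn_univ]
  refine hu.comp h1.contDiffOn fun p _ => ⟨?_, mem_univ _⟩
  exact mem_Ici.2 (by linarith [(clock_bounds hc p.1).1])

theorem extension_eq (hc : 0 < c) {t : ℝ} (ht : c ≤ t) (x : Plane) :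
    extension c u (t, x) = u t x := by
  rw [extension, clock_eq hc ht]

theorem timeDeriv_eq {F : SpaceTime → ℝ} {w : ℝ → Plane → ℝ} (hF : Differentiable ℝ F)
    (hc : 0 ≤ c) (hw : ∀ s, c < s → ∀ x, w s x = F (s, x)) {t : ℝ} (ht : c < t) (x : Plane) :
    timeDeriv w t x = pd timeDir F (t, x) := by
  have h1 : HasDerivAt (fun s => w s x) (pd timeDir F (t, x)) t := by
    refine (hasDerivAt_time hF t x).congr_of_eventuallyEq ?_
    filter_upwards [Ioi_mem_nhds ht] with s hs using hw s hs x
  rw [timeDeriv, derivWithin_of_mem_nhds (Ici_mem_nhds (by linarith)), h1.deriv]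

theorem norm_gradient_sq {f : Plane → ℝ} (x : Plane) :
    ‖gradient f x‖ ^ 2 = fderiv ℝ f x (EuclideanSpace.single 0 1) ^ 2
      + fderiv ℝ f x (EuclideanSpace.single 1 1) ^ 2 := by
  have h : ∀ i : Fin 2, gradient f x i = fderiv ℝ f x (EuclideanSpace.single i 1) := by
    intro i
    have := InnerProductSpace.toDual_symm_apply (𝕜 := ℝ) (x := EuclideanSpace.single i (1 : ℝ))
      (y := fderiv ℝ f x)
    rw [← this, gradient, EuclideanSpace.inner_single_right]
    simp
  simp [EuclideanSpace.norm_sq_eq, h]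

theorem energyDensity_eq {F : SpaceTime → ℝ} (hF : Differentiable ℝ F) (hc : 0 ≤ c)
    (hu : ∀ s, c < s → ∀ x, u s x = F (s, x)) {t : ℝ} (ht : c < t) (x : Plane) :
    energyDensity u t x = density F (t, x) := by
  have h : u t = fun x => F (t, x) := funext (hu t ht)
  rw [energyDensity, norm_gradient_sq, timeDeriv_eq hF hc hu ht, sq_abs, h, fderiv_slice hF,
    fderiv_slice hF]
  rfl

theorem laplacian_slice {F : SpaceTime → ℝ} (hF : ContDiff ℝ 2 F) (t : ℝ) (x : Plane) :
    Laplacian.laplacian (fun y => F (t, y)) x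
      = pd (spaceDir 0) (pd (spaceDir 0) F) (t, x)
        + pd (spaceDir 1) (pd (spaceDir 1) F) (t, x) := by
  have hf : ContDiff ℝ 2 fun y => F (t, y) := by fun_prop
  have hd : Differentiable ℝ (fderiv ℝ fun y => F (t, y)) :=
    (hf.fderiv_right (m := 1) (by norm_num)).differentiable (by norm_num)
  have key : ∀ i : Fin 2, fderiv ℝ (fderiv ℝ fun y => F (t, y)) x (EuclideanSpace.single i 1)
      (EuclideanSpace.single i 1) = pd (spaceDir i) (pd (spaceDir i) F) (t, x) := by
    intro i
    have h1 := fderiv_slice (F := pd (spaceDir i) F)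
      ((contDiff_one_pd hF).differentiable (by norm_num)) t x (EuclideanSpace.single i 1)
    have h2 : (fun y => pd (spaceDir i) F (t, y))
        = fun y => fderiv ℝ (fun z => F (t, z)) y (EuclideanSpace.single i 1) :=
      funext fun y => (fderiv_slice (hF.differentiable (by norm_num)) t y _).symm
    rw [h2] at h1
    have h3 := ((hd x).hasFDerivAt.clm_apply
      (hasFDerivAt_const (EuclideanSpace.single i (1 : ℝ)) x)).fderiv
    rw [h3] at h1
    simpa [spaceDir] using h1
  rw [InnerProductSpace.laplacian_eq_iteratedFDeriv_orthonormalBasis _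
    (EuclideanSpace.basisFun (Fin 2) ℝ)]
  simp [Fin.sum_univ_two, iteratedFDeriv_two_apply, key]

theorem IsClassicalSolution.extension_equation {a u₀ u₁ : Plane → ℝ}
    (hu : IsClassicalSolution a u₀ u₁ u) (hc : 0 < c) {t : ℝ} (ht : c < t) (x : Plane) :
    dalembert (extension c u) (t, x) + a x * pd timeDir (extension c u) (t, x) = 0 := by
  have hW := contDiff_extension hc hu.contDiffOn
  have hext : ∀ s, c < s → ∀ x, u s x = extension c u (s, x) := fun s hs x =>
    (extension_eq hc hs.le x).symm
  have h1 : ∀ s, c < s → ∀ x, timeDeriv u s x = pd timeDir (extension c u) (s, x) :=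
    fun s hs x => timeDeriv_eq (hW.differentiable (by norm_num)) hc.le hext hs x
  have h2 := timeDeriv_eq ((contDiff_one_pd (v := timeDir) hW).differentiable (by norm_num))
    hc.le h1 ht x
  have h3 := hu.equation t (hc.trans ht) x
  rw [h2, h1 t ht x, show u t = fun y => extension c u (t, y) from funext (hext t ht),
    laplacian_slice hW] at h3
  exact h3

end Extension

/-! ### Regularity up to time zero and light cones. -/

section FinitePropagation

variable {u : ℝ → Plane → ℝ}

theorem hasDerivWithinAt_timeDeriv
    (hu : ContDiffOn ℝ 2 (fun p : ℝ × Plane => u p.1 p.2) (Ici 0 ×ˢ univ)) {t : ℝ} (ht : 0 ≤ t)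
    (x : Plane) : HasDerivWithinAt (fun s => u s x)
      (fderivWithin ℝ (fun p : ℝ × Plane => u p.1 p.2) (Ici 0 ×ˢ univ) (t, x) (1, 0)) (Ici 0) t := by
  have h1 := (hu.differentiableOn (by norm_num) (t, x) ⟨ht, mem_univ _⟩).hasFDerivWithinAt
  have h2 : HasDerivWithinAt (fun s : ℝ => (s, x)) (1, 0) (Ici 0) t :=
    (hasDerivWithinAt_id t _).prodMk (hasDerivWithinAt_const t _ x)
  have h3 : MapsTo (fun s : ℝ => (s, x)) (Ici 0) ((Ici 0 : Set ℝ) ×ˢ (univ : Set Plane)) :=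
    fun s hs => ⟨hs, mem_univ _⟩
  exact h1.comp_hasDerivWithinAt t h2 h3

theorem fderiv_eq_fderivWithin
    (hu : ContDiffOn ℝ 2 (fun p : ℝ × Plane => u p.1 p.2) (Ici 0 ×ˢ univ)) {t : ℝ} (ht : 0 ≤ t)
    (x : Plane) : fderiv ℝ (u t) x
      = (fderivWithin ℝ (fun p : ℝ × Plane => u p.1 p.2) (Ici 0 ×ˢ univ) (t, x)).comp
        (ContinuousLinearMap.inr ℝ ℝ Plane) := by
  have h1 := (hu.differentiableOn (by norm_num) (t, x) ⟨ht, mem_univ _⟩).hasFDerivWithinAt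
  have h2 : HasFDerivAt (fun z : Plane => (t, z)) (ContinuousLinearMap.inr ℝ ℝ Plane) x :=
    hasFDerivAt_prodMk_right t x
  have h3 := h1.comp x (h2.hasFDerivWithinAt (s := univ)) fun z _ => ⟨ht, mem_univ _⟩
  rw [hasFDerivWithinAt_univ] at h3
  exact h3.fderiv

/-- One-sided time derivatives and spatial gradients are both read off the derivative within the
closed half-space, which is continuous up to t = 0. -/
theorem continuousOn_energyDensity
    (hu : ContDiffOn ℝ 2 (fun p : ℝ × Plane => u p.1 p.2) (Ici 0 ×ˢ univ)) :
    ContinuousOn (fun p : ℝ × Plane => energyDensity u p.1 p.2) (Ici 0 ×ˢ univ) := by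
  have hun : UniqueDiffOn ℝ ((Ici 0 : Set ℝ) ×ˢ (univ : Set Plane)) :=
    (uniqueDiffOn_Ici 0).prod uniqueDiffOn_univ
  have hf := hu.continuousOn_fderivWithin hun (by norm_num)
  have h : ContinuousOn (fun p : ℝ × Plane =>
      |fderivWithin ℝ (fun p : ℝ × Plane => u p.1 p.2) (Ici 0 ×ˢ univ) p (1, 0)| ^ 2
      + ‖(fderivWithin ℝ (fun p : ℝ × Plane => u p.1 p.2) (Ici 0 ×ˢ univ) p).comp
        (ContinuousLinearMap.inr ℝ ℝ Plane)‖ ^ 2) (Ici 0 ×ˢ univ) :=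
    ((hf.clm_apply continuousOn_const).abs.pow 2).add
      ((hf.clm_comp continuousOn_const).norm.pow 2)
  refine h.congr fun p hp => ?_
  have ht : 0 ≤ p.1 := hp.1
  simp only [energyDensity]
  rw [timeDeriv, (hasDerivWithinAt_timeDeriv hu ht p.2).derivWithin (uniqueDiffOn_Ici 0 _ ht),
    ← fderiv_eq_fderivWithin hu ht, gradient, LinearIsometryEquiv.norm_map]

theorem energyDensity_nonneg (t : ℝ) (x : Plane) : 0 ≤ energyDensity u t x := by
  unfold energyDensity; positivity

/-- A regularised, time-dependent distance to the mantle of the backward light cone with base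
radius `T` around `y`. -/
def coneDepth (T δ : ℝ) (y : Plane) (p : SpaceTime) : ℝ :=
  T - p.1 - √(δ ^ 2 + ((p.2 0 - y 0) ^ 2 + (p.2 1 - y 1) ^ 2))

variable {T δ : ℝ} {y : Plane}

theorem coneDepth_radicand_pos (hδ : 0 < δ) (p : SpaceTime) :
    0 < δ ^ 2 + ((p.2 0 - y 0) ^ 2 + (p.2 1 - y 1) ^ 2) := by positivity

theorem contDiff_coneDepth (hδ : 0 < δ) : ContDiff ℝ 1 (coneDepth T δ y) := by
  have h : ContDiff ℝ 1 fun p : SpaceTime => δ ^ 2 + ((p.2 0 - y 0) ^ 2 + (p.2 1 - y 1) ^ 2) := by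
    fun_prop
  have := h.sqrt fun p => (coneDepth_radicand_pos hδ p).ne'
  unfold coneDepth
  fun_prop

theorem norm_sub_lt_of_coneDepth_pos {p : SpaceTime} (h : 0 < coneDepth T δ y p) :
    ‖p.2 - y‖ < T - p.1 := by
  have h1 : ‖p.2 - y‖ ≤ √(δ ^ 2 + ((p.2 0 - y 0) ^ 2 + (p.2 1 - y 1) ^ 2)) := by
    refine Real.le_sqrt_of_sq_le ?_
    simp only [EuclideanSpace.norm_sq_eq, Fin.sum_univ_two, PiLp.sub_apply, Real.norm_eq_abs,
      sq_abs]
    nlinarith [sq_nonneg δ]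
  unfold coneDepth at h
  linarith

theorem pd_coneDepth_timeDir (hδ : 0 < δ) (p : SpaceTime) :
    pd timeDir (coneDepth T δ y) p = -1 := by
  have h := hasDerivAt_time ((contDiff_coneDepth (T := T) (y := y) hδ).differentiable
    (by norm_num)) p.1 p.2
  have h2 : HasDerivAt (fun s => coneDepth T δ y (s, p.2)) (-1) p.1 := by
    simpa [coneDepth] using ((hasDerivAt_id p.1).const_sub T).sub_const
      (√(δ ^ 2 + ((p.2 0 - y 0) ^ 2 + (p.2 1 - y 1) ^ 2)))
  exact h.unique h2

theorem pd_coneDepth_spaceDir (hδ : 0 < δ) (i : Fin 2) (p : SpaceTime) :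
    pd (spaceDir i) (coneDepth T δ y) p
      = -((p.2 i - y i) / √(δ ^ 2 + ((p.2 0 - y 0) ^ 2 + (p.2 1 - y 1) ^ 2))) := by
  have hpos := coneDepth_radicand_pos (y := y) hδ p
  have d0 : Differentiable ℝ fun p : SpaceTime =>
      ((p.2 0 - y 0) ^ 2 + (p.2 1 - y 1) ^ 2) := by fun_prop
  have d1 : Differentiable ℝ fun p : SpaceTime =>
      δ ^ 2 + ((p.2 0 - y 0) ^ 2 + (p.2 1 - y 1) ^ 2) := by fun_prop
  have d2 : Differentiable ℝ fun p : SpaceTime =>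
      √(δ ^ 2 + ((p.2 0 - y 0) ^ 2 + (p.2 1 - y 1) ^ 2)) :=
    d1.sqrt fun p => (coneDepth_radicand_pos hδ p).ne'
  have h1 := pd_comp (v := spaceDir i) (d1 p) (Real.hasDerivAt_sqrt hpos.ne')
  have hfst : pd (spaceDir i) (fun q => q.1) p = 0 := by
    simp [pd, fderiv_fst, spaceDir]
  unfold coneDepth
  simp (disch := fun_prop) only [pd_sub, pd_const, hfst]
  rw [h1]
  simp (disch := fun_prop) only [pd_add, pd_sq, pd_sub, pd_const, pd_coord_spaceDir]
  have hr : √(δ ^ 2 + ((p.2 0 - y 0) ^ 2 + (p.2 1 - y 1) ^ 2)) ≠ 0 := (Real.sqrt_pos.2 hpos).ne'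
  fin_cases i <;> simp <;> field_simp

end FinitePropagation

/-! ### Finite speed of propagation. -/

section FinitePropagation

variable {u : ℝ → Plane → ℝ} {T δ : ℝ} {y : Plane}

/-- A smooth weight supported in the backward light cone. -/
def coneWeight (T δ : ℝ) (y : Plane) (p : SpaceTime) : ℝ := expNegInvGlue (coneDepth T δ y p)

theorem contDiff_coneWeight (hδ : 0 < δ) : ContDiff ℝ 1 (coneWeight T δ y) := by
  have : ContDiff ℝ 1 expNegInvGlue := expNegInvGlue.contDiff (n := 1)
  exact this.comp (contDiff_coneDepth hδ)

theorem coneWeight_nonneg (p : SpaceTime) : 0 ≤ coneWeight T δ y p := expNegInvGlue.nonneg _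

theorem norm_sub_lt_of_coneWeight_ne_zero {p : SpaceTime} (h : coneWeight T δ y p ≠ 0) :
    ‖p.2 - y‖ < T - p.1 := by
  refine norm_sub_lt_of_coneDepth_pos (δ := δ) ?_
  by_contra hcon
  exact h (expNegInvGlue.zero_of_nonpos (not_lt.1 hcon))

theorem spatiallyBounded_coneWeight (hT : 0 ≤ T) : SpatiallyBounded (coneWeight T δ y) := by
  refine ⟨‖y‖ + T, by positivity, fun p hp => ?_⟩
  by_contra hcon
  have h1 := norm_sub_lt_of_coneWeight_ne_zero hcon
  have h2 : ‖p.2‖ ≤ ‖p.2 - y‖ + ‖y‖ := norm_le_norm_sub_add _ _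
  have h3 := neg_abs_le p.1
  linarith

/-- The weighted energy in a backward light cone has a nonpositive derivative. -/
theorem exists_cone_energy_deriv_nonpos {a : Plane → ℝ} {W : SpaceTime → ℝ}
    (ha_nonneg : ∀ x, 0 ≤ a x) (hW : ContDiff ℝ 2 W) (hT : 0 ≤ T) (hδ : 0 < δ) {t : ℝ}
    (heq : ∀ x, dalembert W (t, x) + a x * pd timeDir W (t, x) = 0) :
    ∃ g, HasDerivAt (fun s => ∫ x, density W (s, x) * coneWeight T δ y (s, x)) g t ∧ g ≤ 0 := by
  refine ⟨_, hasDerivAt_weighted_energy hW (contDiff_coneWeight hδ)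
    (fun v => (spatiallyBounded_coneWeight hT).mul_left _) t, ?_⟩
  refine integral_nonpos fun x => ?_
  have hη : HasDerivAt expNegInvGlue (deriv expNegInvGlue (coneDepth T δ y (t, x)))
      (coneDepth T δ y (t, x)) :=
    ((expNegInvGlue.contDiff (n := 1)).differentiable (by norm_num) _).hasDerivAt
  have hη0 : 0 ≤ deriv expNegInvGlue (coneDepth T δ y (t, x)) := expNegInvGlue.monotone.deriv_nonneg
  have hpd : ∀ v, pd v (coneWeight T δ y) (t, x)
      = deriv expNegInvGlue (coneDepth T δ y (t, x)) * pd v (coneDepth T δ y) (t, x) :=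
    fun v => pd_comp ((contDiff_coneDepth hδ).differentiable (by norm_num) _) hη
  have hψ := coneWeight_nonneg (T := T) (δ := δ) (y := y) (t, x)
  have hpos := coneDepth_radicand_pos (y := y) hδ (t, x)
  simp only [hpd, pd_coneDepth_timeDir hδ, pd_coneDepth_spaceDir hδ, Pi.zero_apply]
  have hr := Real.sqrt_pos.2 hpos
  -- The spatial gradient of the cone depth has length at most 1 while its time derivative is -1. By
  -- Cauchy–Schwarz the loss from the shrinking cone therefore dominates the flux through its
  -- mantle.
  have hn : ((x 0 - y 0) / √(δ ^ 2 + ((x 0 - y 0) ^ 2 + (x 1 - y 1) ^ 2))) ^ 2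
      + ((x 1 - y 1) / √(δ ^ 2 + ((x 0 - y 0) ^ 2 + (x 1 - y 1) ^ 2))) ^ 2 ≤ 1 := by
    rw [div_pow, div_pow, ← add_div, div_le_one (by positivity), Real.sq_sqrt hpos.le]
    nlinarith [sq_nonneg δ]
  simp only at hr
  have hW0 := heq x
  have hax := ha_nonneg x
  simp only [density, gradSq]
  generalize (x 0 - y 0) / √(δ ^ 2 + ((x 0 - y 0) ^ 2 + (x 1 - y 1) ^ 2)) = n₀ at *
  generalize (x 1 - y 1) / √(δ ^ 2 + ((x 0 - y 0) ^ 2 + (x 1 - y 1) ^ 2)) = n₁ at *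
  generalize deriv expNegInvGlue (coneDepth T δ y (t, x)) = η at *
  generalize coneWeight T δ y (t, x) = ψ at *
  have hbox : dalembert W (t, x) = -(a x * pd timeDir W (t, x)) := by linarith
  rw [hbox]
  generalize pd timeDir W (t, x) = τ at *
  generalize pd (spaceDir 0) W (t, x) = w₀ at *
  generalize pd (spaceDir 1) W (t, x) = w₁ at *
  have h1 : 0 ≤ a x * τ ^ 2 * ψ := by positivity
  have h2 : 2 * (τ * (w₀ * n₀ + w₁ * n₁)) ≤ τ ^ 2 + (w₀ ^ 2 + w₁ ^ 2) := by
    have e1 : (w₀ * n₀ + w₁ * n₁) ^ 2 ≤ (w₀ ^ 2 + w₁ ^ 2) * (n₀ ^ 2 + n₁ ^ 2) := by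
      nlinarith [sq_nonneg (w₀ * n₁ - w₁ * n₀)]
    have e2 : (w₀ ^ 2 + w₁ ^ 2) * (n₀ ^ 2 + n₁ ^ 2) ≤ (w₀ ^ 2 + w₁ ^ 2) * 1 :=
      mul_le_mul_of_nonneg_left hn (by positivity)
    nlinarith [sq_nonneg (τ - (w₀ * n₀ + w₁ * n₁))]
  have h3 := mul_le_mul_of_nonneg_left h2 hη0
  nlinarith

variable {a u₀ u₁ : Plane → ℝ} {R : ℝ}

theorem IsClassicalSolution.energyDensity_zero (hu : IsClassicalSolution a u₀ u₁ u)
    (hsupp₀ : tsupport u₀ ⊆ Metric.closedBall 0 R) (hsupp₁ : tsupport u₁ ⊆ Metric.closedBall 0 R)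
    {x : Plane} (hx : R < ‖x‖) : energyDensity u 0 x = 0 := by
  have hx0 : x ∉ tsupport u₀ := fun h => by
    have := hsupp₀ h
    rw [mem_closedBall_zero_iff] at this
    linarith
  have hx1 : x ∉ tsupport u₁ := fun h => by
    have := hsupp₁ h
    rw [mem_closedBall_zero_iff] at this
    linarith
  have h0 : u 0 = u₀ := funext hu.initial_value
  have h1 : fderiv ℝ u₀ x = 0 := by
    have : u₀ =ᶠ[𝓝 x] fun _ => (0 : ℝ) := by
      exact notMem_tsupport_iff_eventuallyEq.1 hx0
    rw [this.fderiv_eq]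
    simp
  rw [energyDensity, hu.initial_velocity, image_eq_zero_of_notMem_tsupport hx1, h0,
    norm_gradient_sq, h1]
  simp

/-- Finite speed of propagation, for the energy density. -/
theorem IsClassicalSolution.energyDensity_eq_zero (hu : IsClassicalSolution a u₀ u₁ u)
    (ha_nonneg : ∀ x, 0 ≤ a x)
    (hsupp₀ : tsupport u₀ ⊆ Metric.closedBall 0 R) (hsupp₁ : tsupport u₁ ⊆ Metric.closedBall 0 R)
    {t : ℝ} (ht : 0 ≤ t) {y : Plane} (hy : R + t < ‖y‖) : energyDensity u t y = 0 := by
  -- With this T the open base of the cone avoids the ball of radius R carrying the data. With the δ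
  -- below, the regularised depth at (t, y) is (T - t)/2, still positive.
  set T : ℝ := ‖y‖ - R with hT
  have hTt : t < T := by rw [hT]; linarith
  have hT0 : 0 ≤ T := by linarith
  set δ : ℝ := (T - t) / 2 with hδdef
  have hδ : 0 < δ := by rw [hδdef]; linarith
  -- Replacing t by max t 0 discards the meaningless negative times and yields a continuous function
  -- on all of space-time, so the weighted energy is continuous down to t = 0.
  have hcont : Continuous fun p : SpaceTime =>
      energyDensity u (max p.1 0) p.2 * coneWeight T δ y p := by
    refine Continuous.mul ?_ (contDiff_coneWeight hδ).continuous
    exact (continuousOn_energyDensity hu.contDiffOn).comp_continuous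
      (f := fun p : SpaceTime => (max p.1 0, p.2)) (by fun_prop)
      fun p => ⟨mem_Ici.2 (le_max_right _ _), mem_univ _⟩
  have hb : SpatiallyBounded fun p : SpaceTime =>
      energyDensity u (max p.1 0) p.2 * coneWeight T δ y p :=
    (spatiallyBounded_coneWeight hT0).mul_left _
  have hloc : ∀ s, 0 < s → ∃ g, HasDerivAt (fun s => ∫ x,
      energyDensity u (max s 0) x * coneWeight T δ y (s, x)) g s ∧ g ≤ 0 := by
    intro s hs
    -- The extension with cut-off s/2 agrees with u near time s, which is all the derivative at s
    -- needs.
    have hc : 0 < s / 2 := by linarith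
    obtain ⟨g, hg, hg0⟩ := exists_cone_energy_deriv_nonpos (T := T) (δ := δ) (y := y) ha_nonneg
      (contDiff_extension hc hu.contDiffOn) hT0 hδ
      (fun x => hu.extension_equation hc (by linarith : s / 2 < s) x)
    refine ⟨g, hg.congr_of_eventuallyEq ?_, hg0⟩
    filter_upwards [Ioi_mem_nhds (by linarith : s / 2 < s)] with r hr
    have hr0 : 0 ≤ r := hc.le.trans (le_of_lt hr)
    rw [max_eq_left hr0]
    refine integral_congr_ae (Eventually.of_forall fun x => ?_)
    simp only
    rw [energyDensity_eq ((contDiff_extension hc hu.contDiffOn).differentiable (by norm_num)) hc.le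
      (fun q hq z => (extension_eq hc (le_of_lt hq) z).symm) hr]
  have hanti : AntitoneOn (fun s => ∫ x, energyDensity u (max s 0) x * coneWeight T δ y (s, x))
      (Ici 0) := by
    refine antitoneOn_of_deriv_nonpos (convex_Ici 0)
      (hb.continuous_integral hcont).continuousOn ?_ ?_
    · intro s hs
      rw [interior_Ici] at hs
      obtain ⟨g, hg, -⟩ := hloc s hs
      exact hg.differentiableAt.differentiableWithinAt
    · intro s hs
      rw [interior_Ici] at hs
      obtain ⟨g, hg, hg0⟩ := hloc s hs
      rwa [hg.deriv]
  have hinit : ∫ x, energyDensity u (max 0 0) x * coneWeight T δ y (0, x) = 0 := by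
    refine integral_eq_zero_of_ae (Eventually.of_forall fun x => ?_)
    simp only [max_self, Pi.zero_apply]
    by_cases hx : coneWeight T δ y (0, x) = 0
    · rw [hx, mul_zero]
    · have h1 := norm_sub_lt_of_coneWeight_ne_zero hx
      simp only [sub_zero] at h1
      have h2 : ‖y‖ ≤ ‖x - y‖ + ‖x‖ := by
        rw [norm_sub_rev]; exact norm_le_norm_sub_add _ _
      rw [hu.energyDensity_zero hsupp₀ hsupp₁ (by rw [hT] at h1; linarith), zero_mul]
  have hle := hanti (mem_Ici.2 le_rfl) (mem_Ici.2 ht) ht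
  simp only at hle
  rw [hinit] at hle
  by_contra hne
  have hwt : coneWeight T δ y (t, y) ≠ 0 := by
    refine (expNegInvGlue.pos_of_pos ?_).ne'
    simp only [coneDepth, sub_self]
    have : √(δ ^ 2 + (0 ^ 2 + 0 ^ 2)) = δ := by
      norm_num
      exact Real.sqrt_sq hδ.le
    rw [this, hδdef]
    linarith
  have hpos : 0 < ∫ x, energyDensity u (max t 0) x * coneWeight T δ y (t, x) := by
    refine Continuous.integral_pos_of_hasCompactSupport_nonneg_nonzero (x := y)
      (f := fun x => energyDensity u (max t 0) x * coneWeight T δ y (t, x))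
      (hcont.comp (by fun_prop : Continuous fun x : Plane => ((t, x) : SpaceTime)))
      (hb.hasCompactSupport t)
      (fun x => mul_nonneg (energyDensity_nonneg _ _) (coneWeight_nonneg _)) ?_
    rw [max_eq_left ht]
    exact mul_ne_zero hne hwt
  linarith

/-- Finite speed of propagation. -/
theorem IsClassicalSolution.eq_zero (hu : IsClassicalSolution a u₀ u₁ u)
    (ha_nonneg : ∀ x, 0 ≤ a x)
    (hsupp₀ : tsupport u₀ ⊆ Metric.closedBall 0 R) (hsupp₁ : tsupport u₁ ⊆ Metric.closedBall 0 R)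
    {t : ℝ} (ht : 0 ≤ t) {y : Plane} (hy : R + t < ‖y‖) : u t y = 0 := by
  have hder : ∀ s, 0 ≤ s → HasDerivWithinAt (fun s => u s y) (timeDeriv u s y) (Ici 0) s := by
    intro s hs
    have h := hasDerivWithinAt_timeDeriv hu.contDiffOn hs y
    rw [timeDeriv, h.derivWithin (uniqueDiffOn_Ici 0 s hs)]
    exact h
  -- The energy density controls only derivatives. At y it vanishes for all earlier times too, so
  -- u(·, y) keeps its initial value, which is 0.
  have hconst := constant_of_has_deriv_right_zero (f := fun s => u s y) (a := 0) (b := t)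
    (fun s hs => ((hder s hs.1).continuousWithinAt).mono fun r hr => hr.1) fun s hs => by
      have h1 : energyDensity u s y = 0 := hu.energyDensity_eq_zero ha_nonneg hsupp₀ hsupp₁ hs.1
        (by linarith [hs.2])
      have h2 : timeDeriv u s y = 0 := by
        have h3 : |timeDeriv u s y| ^ 2 = 0 := by
          have := sq_nonneg ‖gradient (u s) y‖
          have := sq_nonneg |timeDeriv u s y|
          unfold energyDensity at h1
          linarith
        simpa using h3
      have h4 := (hder s hs.1).mono (Ici_subset_Ici.2 hs.1)
      rwa [h2] at h4
  have h0 : u₀ y = 0 := by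
    refine image_eq_zero_of_notMem_tsupport fun h => ?_
    have := hsupp₀ h
    rw [mem_closedBall_zero_iff] at this
    linarith
  have := hconst t ⟨ht, le_rfl⟩
  rw [this, hu.initial_value, h0]

theorem IsClassicalSolution.spatiallyBounded_extension (hu : IsClassicalSolution a u₀ u₁ u)
    (ha_nonneg : ∀ x, 0 ≤ a x) (hR : 0 ≤ R)
    (hsupp₀ : tsupport u₀ ⊆ Metric.closedBall 0 R) (hsupp₁ : tsupport u₁ ⊆ Metric.closedBall 0 R)
    {c : ℝ} (hc : 0 < c) : SpatiallyBounded (extension c u) := by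
  refine ⟨R + c, by linarith, fun p hp => ?_⟩
  have hb := clock_bounds hc p.1
  exact hu.eq_zero ha_nonneg hsupp₀ hsupp₁ (by linarith) (by linarith)

end FinitePropagation

end DampedWave

end

/-! ### The decay theorem. -/

theorem theorem1p1 (R L ε₀ : ℝ) (a u₀ u₁ : DampedWave.Plane → ℝ)
    (u : ℝ → DampedWave.Plane → ℝ)
    (hR : 0 < R)
    (hu₀ : ContDiff ℝ ∞ u₀) (hu₁ : ContDiff ℝ ∞ u₁)
    (hsupp₀ : tsupport u₀ ⊆ Metric.closedBall 0 R)
    (hsupp₁ : tsupport u₁ ⊆ Metric.closedBall 0 R)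
    (ha : ContDiff ℝ 2 a) (ha_nonneg : ∀ x, 0 ≤ a x) (ha_bdd : ∃ M : ℝ, ∀ x, |a x| ≤ M)
    (hL : 0 < L) (hε₀ : 0 < ε₀) (ha_far : ∀ x, L < ‖x‖ → ε₀ ≤ a x)
    (hu : DampedWave.IsClassicalSolution a u₀ u₁ u) :
    (∀ t : ℝ, 0 ≤ t → Integrable (fun x => |u t x| ^ 2) ∧
      Integrable (DampedWave.energyDensity u t)) ∧
    (fun t : ℝ => ∫ x, |u t x| ^ 2) =O[atTop] (fun t : ℝ => t⁻¹ * Real.log t) ∧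
    (fun t : ℝ => DampedWave.energy u t) =O[atTop] (fun t : ℝ => (t ^ 2)⁻¹ * Real.log t) := by
  open DampedWave in
  refine ⟨fun t ht => ⟨?_, ?_⟩, ?_⟩
  · have hslice : Continuous fun x => |u t x| ^ 2 := by
      have : Continuous fun x : Plane => u t x :=
        hu.contDiffOn.continuousOn.comp_continuous (f := fun x : Plane => ((t, x) : ℝ × Plane))
          (by fun_prop) fun x => ⟨ht, mem_univ _⟩
      fun_prop
    refine hslice.integrable_of_hasCompactSupport
      (HasCompactSupport.intro (isCompact_closedBall (0 : Plane) (R + t)) fun x hx => ?_)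
    rw [hu.eq_zero ha_nonneg hsupp₀ hsupp₁ ht (by simpa using hx)]
    simp
  · have hslice : Continuous (energyDensity u t) :=
      (continuousOn_energyDensity hu.contDiffOn).comp_continuous
        (f := fun x : Plane => ((t, x) : ℝ × Plane)) (by fun_prop) fun x => ⟨ht, mem_univ _⟩
    exact hslice.integrable_of_hasCompactSupport
      (HasCompactSupport.intro (isCompact_closedBall (0 : Plane) (R + t)) fun x hx =>
        hu.energyDensity_eq_zero ha_nonneg hsupp₀ hsupp₁ ht (by simpa using hx))
  · obtain ⟨M, hM⟩ := ha_bdd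
    -- Any cut-off below 1 would do: the extended function must solve the equation at every t ≥ 1,
    -- the base time of the primitive.
    have hc : (0 : ℝ) < 1 / 2 := by norm_num
    have hW := contDiff_extension hc hu.contDiffOn
    obtain ⟨K, hK⟩ := exists_decay ha ha_nonneg (fun x => (le_abs_self _).trans (hM x)) hL hε₀
      ha_far hW (hu.spatiallyBounded_extension ha_nonneg hR.le hsupp₀ hsupp₁ hc)
      (fun t ht x => hu.extension_equation hc (by linarith) x)
    have hlog : ∀ t : ℝ, 2 ≤ t → 0 ≤ Real.log t := fun t ht => Real.log_nonneg (by linarith)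
    have hN : ∀ t : ℝ, 2 ≤ t →
        ∫ x, |u t x| ^ 2 = ∫ x, extension (1 / 2) u (t, x) ^ 2 := fun t ht => by
      simp only [sq_abs, extension_eq hc (by linarith : 1 / 2 ≤ t)]
    have hE : ∀ t : ℝ, 2 ≤ t →
        ∫ x, energyDensity u t x = ∫ x, density (extension (1 / 2) u) (t, x) := fun t ht => by
      refine integral_congr_ae (Eventually.of_forall fun x => ?_)
      exact energyDensity_eq (hW.differentiable (by norm_num)) hc.le
        (fun q hq z => (extension_eq hc (le_of_lt hq) z).symm) (by linarith) x
    refine ⟨IsBigO.of_bound K ?_, IsBigO.of_bound (1 / 2 * K) ?_⟩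
    · filter_upwards [eventually_ge_atTop 2] with t ht
      have hl := hlog t ht
      rw [Real.norm_of_nonneg (integral_nonneg fun x => by positivity),
        Real.norm_of_nonneg (by positivity), hN t ht]
      exact (hK t ht).1
    · filter_upwards [eventually_ge_atTop 2] with t ht
      have hl := hlog t ht
      have h0 : 0 ≤ ∫ x, energyDensity u t x := integral_nonneg fun x => energyDensity_nonneg t x
      rw [energy, Real.norm_of_nonneg (by positivity), Real.norm_of_nonneg (by positivity),
        hE t ht, mul_assoc]
      exact mul_le_mul_of_nonneg_left (hK t ht).2 hc.le
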